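/- Let $\mathbf B$ be a symmetric monoidal bicategory (fully weak: tensor pseudofunctor, unit object $I$, associator, unitors and braiding as pseudonatural adjoint equivalences, with pentagonator, unit modifications, hexagonators and syllepsis satisfying the usual coherence axioms), equipped with a dagger: an involution $\beta\mapsto\beta^\dagger$ on 2-cells, $S\xrightarrow{\beta}T$ going to $T\xrightarrow{\beta^\dagger}S$, which is the identity on objects and 1-cells, is contravariantly functorial on 2-cells, and preserves horizontal composition, the tensor product and all structural 2-cells (i.e. the structural 2-cells are unitary). The 1-cells $I\to I$ and the 2-cells between them form the category of scalars $\mathbf B(I,I)$, monoidal under composition of 1-cells. For scalars $S,T$ let $\sigma_{S,T}\colon S\circ T\cong T\circ S$ be the crossing, obtained by moving the two scalars to different factors of $I\otimes I\simeq I$ with the unitors and applying the interchange isomorphism of the tensor product. A witness for an object $A$ consists of 1-cells $w\colon I\to A$ and $w'\colon A\to I$ with 2-cells (composites of 1-cells being written in diagrammatic order) $$\mathrm{create}\colon \mathrm{id}_I\Rightarrow w\,w',\qquad \mathrm{compare}\colon w'\,w\Rightarrow \mathrm{id}_A,\qquad \mathrm{delete}=\mathrm{create}^\dagger,\qquad \mathrm{copy}=\mathrm{compare}^\dagger,$$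 such that $(\mathrm{create},\mathrm{compare})$ and $(\mathrm{copy},\mathrm{delete})$ are unit and counit of adjunctions $w\dashv w'$ and $w'\dashv w$; copying followed by comparing is the identity of $\mathrm{id}_A$; and $m\circ\sigma_{X,X}=m$, where $X=w\,w'$ is the composite $I\to A\to I$ and $m\colon X X=w\,(w'\,w)\,w'\Rightarrow w\,w'=X$ is obtained by whiskering $\mathrm{compare}$ with $w$ and $w'$. Then: 1. The scalars, with composition as tensor product, the crossings $\sigma_{S,T}$ as braiding, and the dagger of $\mathbf B$, form a symmetric monoidal dagger category. 2. For every witness for every object $A$, the scalar $X\colon I\to A\to I$ with multiplication $m$ and unit $\mathrm{create}$ is a special commutative $\dagger$-Frobenius algebra in this category: $(X,m,\mathrm{create})$ is a commutative monoid, $(X,m^\dagger,\mathrm{create}^\dagger)$ is a comonoid, the Frobenius equations $(\mathrm{id}\otimes m)(m^\dagger\otimes\mathrm{id})=m^\dagger m=(m\otimes\mathrm{id})(\mathrm{id}\otimes m^\dagger)$ hold, and $m\,m^\dagger=\mathrm{id}_X$. -/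

import Mathlib

open CategoryTheory

universe w v u w₁ v₁ u₁ w₂ v₂ u₂

namespace SymBicat

section Bicategories

open Bicategory
open scoped Pseudofunctor.StrongTrans

/-! ### Tensor products on a bicategory -/

/-- The pseudofunctor into a product of bicategories with given components. -/
def pairing {D : Type u₂} [Bicategory.{w₂, v₂} D] {B : Type u} [Bicategory.{w, v} B]
    {C : Type u₁} [Bicategory.{w₁, v₁} C] (F : D ⥤ᵖ B) (G : D ⥤ᵖ C) : D ⥤ᵖ (B × C) where
  obj X := (F.obj X, G.obj X)
  map f := (F.map f, G.map f)
  map₂ η := (F.map₂ η, G.map₂ η)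
  mapId X := Iso.prod (F.mapId X) (G.mapId X)
  mapComp f g := Iso.prod (F.mapComp f g) (G.mapComp f g)

/-- A bicategory with a tensor pseudofunctor and a unit object. -/
class TensorBicategory (B : Type u) [Bicategory.{w, v} B] where
  /-- the tensor product -/
  tensor : (B × B) ⥤ᵖ B
  /-- the unit object -/
  unit : B

section Tensor

variable {B : Type u} [Bicategory.{w, v} B] [TensorBicategory B]

/-- The tensor product of objects. -/
def tObj (X Y : B) : B := (TensorBicategory.tensor (B := B)).obj (X, Y)

infixr:92 " ⊠ " => tObj

/-- The tensor product of 1-cells. -/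
def tMap {X X' Y Y' : B} (f : X ⟶ X') (g : Y ⟶ Y') : X ⊠ Y ⟶ X' ⊠ Y' :=
  (TensorBicategory.tensor (B := B)).map (X := (X, Y)) (Y := (X', Y')) (f, g)

infixr:92 " ⊠₁ " => tMap

/-- The tensor product of 2-cells. -/
def tMap₂ {X X' Y Y' : B} {f f' : X ⟶ X'} {g g' : Y ⟶ Y'} (η : f ⟶ f') (θ : g ⟶ g') :
    f ⊠₁ g ⟶ f' ⊠₁ g' :=
  (TensorBicategory.tensor (B := B)).map₂ (a := (X, Y)) (b := (X', Y'))
    (f := (f, g)) (g := (f', g')) (η, θ)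

/-- The tensor product of invertible 2-cells. -/
def tIso {X X' Y Y' : B} {f f' : X ⟶ X'} {g g' : Y ⟶ Y'} (η : f ≅ f') (θ : g ≅ g') :
    f ⊠₁ g ≅ f' ⊠₁ g' :=
  (TensorBicategory.tensor (B := B)).map₂Iso (a := (X, Y)) (b := (X', Y'))
    (f := (f, g)) (g := (f', g')) (Iso.prod η θ)

infixr:92 " ⊠ᵢ " => tIso

/-- The constraint 2-cell comparing the tensor product with composition. -/
def tComp {X X' X'' Y Y' Y'' : B} (f : X ⟶ X') (f' : X' ⟶ X'') (g : Y ⟶ Y') (g' : Y' ⟶ Y'') :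
    (f ≫ f') ⊠₁ (g ≫ g') ≅ f ⊠₁ g ≫ f' ⊠₁ g' :=
  (TensorBicategory.tensor (B := B)).mapComp (a := (X, Y)) (b := (X', Y')) (c := (X'', Y''))
    (f, g) (f', g')

/-- The constraint 2-cell comparing the tensor product with identities. -/
def tId (X Y : B) : 𝟙 X ⊠₁ 𝟙 Y ≅ 𝟙 (X ⊠ Y) :=
  (TensorBicategory.tensor (B := B)).mapId (X, Y)

variable (B)

/-- The pseudofunctor `(X, Y, Z) ↦ (X ⊠ Y) ⊠ Z`. -/
def leftNested : (B × (B × B)) ⥤ᵖ B :=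
  (pairing
    ((pairing (Bicategory.Prod.fst B (B × B)).toPseudofunctor
      ((Bicategory.Prod.snd B (B × B)).toPseudofunctor.comp
        (Bicategory.Prod.fst B B).toPseudofunctor)).comp TensorBicategory.tensor)
    ((Bicategory.Prod.snd B (B × B)).toPseudofunctor.comp
      (Bicategory.Prod.snd B B).toPseudofunctor)).comp TensorBicategory.tensor

/-- The pseudofunctor `(X, Y, Z) ↦ X ⊠ (Y ⊠ Z)`. -/
def rightNested : (B × (B × B)) ⥤ᵖ B :=
  (pairing (Bicategory.Prod.fst B (B × B)).toPseudofunctor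
    ((Bicategory.Prod.snd B (B × B)).toPseudofunctor.comp TensorBicategory.tensor)).comp
      TensorBicategory.tensor

/-- The pseudofunctor `X ↦ I ⊠ X`. -/
def unitTensor : B ⥤ᵖ B :=
  (Bicategory.Prod.sectR (TensorBicategory.unit (B := B)) B).toPseudofunctor.comp
    TensorBicategory.tensor

/-- The pseudofunctor `X ↦ X ⊠ I`. -/
def tensorUnit : B ⥤ᵖ B :=
  (Bicategory.Prod.sectL B (TensorBicategory.unit (B := B))).toPseudofunctor.comp
    TensorBicategory.tensor

/-- The pseudofunctor `(X, Y) ↦ Y ⊠ X`. -/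
def swapTensor : (B × B) ⥤ᵖ B :=
  (Bicategory.Prod.swap B B).toPseudofunctor.comp TensorBicategory.tensor

end Tensor

/-- A tensor bicategory with an associator and unitors: adjoint equivalences in the bicategories
of pseudofunctors, pseudonatural transformations and modifications. -/
class CoherenceData (B : Type u) [Bicategory.{w, v} B] extends TensorBicategory B where
  /-- the associator -/
  associator : leftNested B ≌ rightNested B
  /-- the left unitor -/
  leftUnitor : unitTensor B ≌ Pseudofunctor.id B
  /-- the right unitor -/
  rightUnitor : tensorUnit B ≌ Pseudofunctor.id B

/-! ### Squares of 1-cells filled by an invertible 2-cell -/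

section Squares

variable {B : Type u} [Bicategory.{w, v} B]

/-- An invertible 2-cell filling the square with top `f`, left `p`, right `q`, bottom `g`. -/
abbrev Sq {X X' Y Y' : B} (f : X ⟶ Y) (p : X ⟶ X') (q : Y ⟶ Y') (g : X' ⟶ Y') : Type w :=
  f ≫ q ≅ p ≫ g

/-- The identity square on `f`. -/
def Sq.vid {X Y : B} (f : X ⟶ Y) : Sq f (𝟙 X) (𝟙 Y) f := ρ_ f ≪≫ (λ_ f).symm

/-- Vertical pasting of squares. -/
def Sq.vcomp {X X' X'' Y Y' Y'' : B} {f : X ⟶ Y} {p : X ⟶ X'} {q : Y ⟶ Y'} {g : X' ⟶ Y'}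
    {p' : X' ⟶ X''} {q' : Y' ⟶ Y''} {h : X'' ⟶ Y''} (s : Sq f p q g) (t : Sq g p' q' h) :
    Sq f (p ≫ p') (q ≫ q') h :=
  (α_ f q q').symm ≪≫ s ▷ᵢ q' ≪≫ α_ p g q' ≪≫ p ◁ᵢ t ≪≫ (α_ p p' h).symm

infixr:80 " ⊚ " => Sq.vcomp

/-- The modification condition for the 2-cells `Γ` (over the source) and `Γ'` (over the target),
from the naturality square `s` to the naturality square `t`. -/
def IsModification {X X' Y Y' : B} {f : X ⟶ Y} {g : X' ⟶ Y'} {p p' : X ⟶ X'} {q q' : Y ⟶ Y'}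
    (s : Sq f p q g) (t : Sq f p' q' g) (Γ : p ≅ p') (Γ' : q ≅ q') : Prop :=
  f ◁ Γ'.hom ≫ t.hom = s.hom ≫ Γ.hom ▷ g

/-- Tensor product of squares. -/
def Sq.tensor [TensorBicategory B] {X X' Y Y' Z Z' W W' : B}
    {f : X ⟶ Y} {p : X ⟶ X'} {q : Y ⟶ Y'} {g : X' ⟶ Y'}
    {f' : Z ⟶ W} {p' : Z ⟶ Z'} {q' : W ⟶ W'} {g' : Z' ⟶ W'}
    (s : Sq f p q g) (t : Sq f' p' q' g') : Sq (f ⊠₁ f') (p ⊠₁ p') (q ⊠₁ q') (g ⊠₁ g') :=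
  (tComp f q f' q').symm ≪≫ s ⊠ᵢ t ≪≫ tComp p g p' g'

infixr:90 " ⊠ₛ " => Sq.tensor

/-- Cancellation of a 1-cell with a right inverse on the right. -/
def cancelRight {X Y Z : B} {f g : X ⟶ Y} {e : Y ⟶ Z} {e' : Z ⟶ Y} (η : 𝟙 Y ≅ e ≫ e')
    (s : f ≫ e ≅ g ≫ e) : f ≅ g :=
  (ρ_ f).symm ≪≫ f ◁ᵢ η ≪≫ (α_ f e e').symm ≪≫ s ▷ᵢ e' ≪≫ α_ g e e' ≪≫ g ◁ᵢ η.symm ≪≫ ρ_ g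

/-- Cancellation of a 1-cell with a left inverse on the left. -/
def cancelLeft {X Y Z : B} {f g : Y ⟶ Z} {e : X ⟶ Y} {e' : Y ⟶ X} (κ : e' ≫ e ≅ 𝟙 Y)
    (s : e ≫ f ≅ e ≫ g) : f ≅ g :=
  (λ_ f).symm ≪≫ κ.symm ▷ᵢ f ≪≫ α_ e' e f ≪≫ e' ◁ᵢ s ≪≫ (α_ e' e g).symm ≪≫ κ ▷ᵢ g ≪≫ λ_ g

end Squares

/-! ### Tensoring 1-cells and 2-cells with an object -/

section Whisker

variable {B : Type u} [Bicategory.{w, v} B] [TensorBicategory B]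

/-- `X ⊠ f` for an object `X`. -/
def wL (X : B) {Y Y' : B} (f : Y ⟶ Y') : X ⊠ Y ⟶ X ⊠ Y' := 𝟙 X ⊠₁ f

/-- `f ⊠ Y` for an object `Y`. -/
def wR {X X' : B} (f : X ⟶ X') (Y : B) : X ⊠ Y ⟶ X' ⊠ Y := f ⊠₁ 𝟙 Y

infixr:93 " ◂ " => wL
infixl:93 " ▸ₜ " => wR

variable {X X₁ X₂ X₃ X₄ X₅ X₆ : B}

def wLIso (Y : B) {f g : X ⟶ X₁} (η : f ≅ g) : Y ◂ f ≅ Y ◂ g := Iso.refl (𝟙 Y) ⊠ᵢ η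

def wRIso {f g : X ⟶ X₁} (η : f ≅ g) (Y : B) : f ▸ₜ Y ≅ g ▸ₜ Y := η ⊠ᵢ Iso.refl (𝟙 Y)

def wLComp (Y : B) (f : X ⟶ X₁) (g : X₁ ⟶ X₂) : Y ◂ (f ≫ g) ≅ Y ◂ f ≫ Y ◂ g :=
  (λ_ (𝟙 Y)).symm ⊠ᵢ Iso.refl (f ≫ g) ≪≫ tComp (𝟙 Y) (𝟙 Y) f g

def wRComp (f : X ⟶ X₁) (g : X₁ ⟶ X₂) (Y : B) : (f ≫ g) ▸ₜ Y ≅ f ▸ₜ Y ≫ g ▸ₜ Y :=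
  Iso.refl (f ≫ g) ⊠ᵢ (λ_ (𝟙 Y)).symm ≪≫ tComp f g (𝟙 Y) (𝟙 Y)

def wLComp₃ (Y : B) (f : X ⟶ X₁) (g : X₁ ⟶ X₂) (h : X₂ ⟶ X₃) :
    Y ◂ (f ≫ g ≫ h) ≅ Y ◂ f ≫ Y ◂ g ≫ Y ◂ h :=
  wLComp Y f (g ≫ h) ≪≫ (Y ◂ f) ◁ᵢ wLComp Y g h

def wRComp₃ (f : X ⟶ X₁) (g : X₁ ⟶ X₂) (h : X₂ ⟶ X₃) (Y : B) :
    (f ≫ g ≫ h) ▸ₜ Y ≅ f ▸ₜ Y ≫ g ▸ₜ Y ≫ h ▸ₜ Y :=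
  wRComp f (g ≫ h) Y ≪≫ (f ▸ₜ Y) ◁ᵢ wRComp g h Y

/-! The next definitions tensor a 2-cell between composites with an object; the digits count the
factors of the source and of the target. -/

def wL21 (Y : B) {f : X ⟶ X₁} {g : X₁ ⟶ X₂} {k : X ⟶ X₂} (η : f ≫ g ≅ k) :
    Y ◂ f ≫ Y ◂ g ≅ Y ◂ k :=
  (wLComp Y f g).symm ≪≫ wLIso Y η

def wR21 {f : X ⟶ X₁} {g : X₁ ⟶ X₂} {k : X ⟶ X₂} (η : f ≫ g ≅ k) (Y : B) :
    f ▸ₜ Y ≫ g ▸ₜ Y ≅ k ▸ₜ Y :=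
  (wRComp f g Y).symm ≪≫ wRIso η Y

def wL20 (Y : B) {f : X ⟶ X₁} {g : X₁ ⟶ X} (η : f ≫ g ≅ 𝟙 X) : Y ◂ f ≫ Y ◂ g ≅ 𝟙 (Y ⊠ X) :=
  wL21 Y η ≪≫ tId Y X

def wR20 {f : X ⟶ X₁} {g : X₁ ⟶ X} (η : f ≫ g ≅ 𝟙 X) (Y : B) : f ▸ₜ Y ≫ g ▸ₜ Y ≅ 𝟙 (X ⊠ Y) :=
  wR21 η Y ≪≫ tId X Y

def wL32 (Y : B) {f : X ⟶ X₁} {g : X₁ ⟶ X₂} {h : X₂ ⟶ X₃} {k : X ⟶ X₄} {l : X₄ ⟶ X₃}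
    (η : f ≫ g ≫ h ≅ k ≫ l) : Y ◂ f ≫ Y ◂ g ≫ Y ◂ h ≅ Y ◂ k ≫ Y ◂ l :=
  (wLComp₃ Y f g h).symm ≪≫ wLIso Y η ≪≫ wLComp Y k l

def wR32 {f : X ⟶ X₁} {g : X₁ ⟶ X₂} {h : X₂ ⟶ X₃} {k : X ⟶ X₄} {l : X₄ ⟶ X₃}
    (η : f ≫ g ≫ h ≅ k ≫ l) (Y : B) : f ▸ₜ Y ≫ g ▸ₜ Y ≫ h ▸ₜ Y ≅ k ▸ₜ Y ≫ l ▸ₜ Y :=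
  (wRComp₃ f g h Y).symm ≪≫ wRIso η Y ≪≫ wRComp k l Y

def wL33 (Y : B) {f : X ⟶ X₁} {g : X₁ ⟶ X₂} {h : X₂ ⟶ X₃} {k : X ⟶ X₄} {l : X₄ ⟶ X₅}
    {m : X₅ ⟶ X₃} (η : f ≫ g ≫ h ≅ k ≫ l ≫ m) :
    Y ◂ f ≫ Y ◂ g ≫ Y ◂ h ≅ Y ◂ k ≫ Y ◂ l ≫ Y ◂ m :=
  (wLComp₃ Y f g h).symm ≪≫ wLIso Y η ≪≫ wLComp₃ Y k l m

def wR33 {f : X ⟶ X₁} {g : X₁ ⟶ X₂} {h : X₂ ⟶ X₃} {k : X ⟶ X₄} {l : X₄ ⟶ X₅}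
    {m : X₅ ⟶ X₃} (η : f ≫ g ≫ h ≅ k ≫ l ≫ m) (Y : B) :
    f ▸ₜ Y ≫ g ▸ₜ Y ≫ h ▸ₜ Y ≅ k ▸ₜ Y ≫ l ▸ₜ Y ≫ m ▸ₜ Y :=
  (wRComp₃ f g h Y).symm ≪≫ wRIso η Y ≪≫ wRComp₃ k l m Y

/-- The interchange 2-cell `(f ⊠ Y) ≫ (X' ⊠ g) ≅ (X ⊠ g) ≫ (f ⊠ Y')`. -/
def interchange {X X' Y Y' : B} (f : X ⟶ X') (g : Y ⟶ Y') :
    f ▸ₜ Y ≫ X' ◂ g ≅ X ◂ g ≫ f ▸ₜ Y' :=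
  (tComp f (𝟙 X') (𝟙 Y) g).symm ≪≫ (ρ_ f ≪≫ (λ_ f).symm) ⊠ᵢ (λ_ g ≪≫ (ρ_ g).symm) ≪≫
    tComp (𝟙 X) f g (𝟙 Y')

end Whisker

/-! ### Components of the associator and of the unitors -/

section Components

variable {B : Type u} [Bicategory.{w, v} B] [CoherenceData B]

/-- The unit object. -/
abbrev I : B := TensorBicategory.unit

/-- Components of the associator. -/
def a (X Y Z : B) : (X ⊠ Y) ⊠ Z ⟶ X ⊠ (Y ⊠ Z) :=
  (CoherenceData.associator (B := B)).hom.app (X, (Y, Z))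

/-- Components of the inverse associator. -/
def a' (X Y Z : B) : X ⊠ (Y ⊠ Z) ⟶ (X ⊠ Y) ⊠ Z :=
  (CoherenceData.associator (B := B)).inv.app (X, (Y, Z))

/-- The invertible 2-cell at an object underlying an invertible modification. -/
def modApp {C : Type u₁} [Bicategory.{w₁, v₁} C] {F G : C ⥤ᵖ B} {σ τ : F ⟶ G} (Γ : σ ≅ τ) (X : C) :
    σ.app X ≅ τ.app X where
  hom := Γ.hom.as.app X
  inv := Γ.inv.as.app X
  hom_inv_id := congrArg (fun m => m.as.app X) Γ.hom_inv_id
  inv_hom_id := congrArg (fun m => m.as.app X) Γ.inv_hom_id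

def aUnit (X Y Z : B) : 𝟙 ((X ⊠ Y) ⊠ Z) ≅ a X Y Z ≫ a' X Y Z :=
  modApp (CoherenceData.associator (B := B)).unit (X, (Y, Z))

def aCounit (X Y Z : B) : a' X Y Z ≫ a X Y Z ≅ 𝟙 (X ⊠ (Y ⊠ Z)) :=
  modApp (CoherenceData.associator (B := B)).counit (X, (Y, Z))

/-- Pseudonaturality of the associator. -/
def aNat {X X' Y Y' Z Z' : B} (f : X ⟶ X') (g : Y ⟶ Y') (h : Z ⟶ Z') :
    Sq ((f ⊠₁ g) ⊠₁ h) (a X Y Z) (a X' Y' Z') (f ⊠₁ (g ⊠₁ h)) :=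
  (CoherenceData.associator (B := B)).hom.naturality (a := (X, (Y, Z))) (b := (X', (Y', Z')))
    (f, (g, h))

/-- Pseudonaturality of the inverse associator. -/
def aNat' {X X' Y Y' Z Z' : B} (f : X ⟶ X') (g : Y ⟶ Y') (h : Z ⟶ Z') :
    Sq (f ⊠₁ (g ⊠₁ h)) (a' X Y Z) (a' X' Y' Z') ((f ⊠₁ g) ⊠₁ h) :=
  (CoherenceData.associator (B := B)).inv.naturality (a := (X, (Y, Z))) (b := (X', (Y', Z')))
    (f, (g, h))

def aNat₁ {X X' : B} (f : X ⟶ X') (Y Z : B) :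
    Sq ((f ▸ₜ Y) ▸ₜ Z) (a X Y Z) (a X' Y Z) (f ▸ₜ (Y ⊠ Z)) :=
  aNat f (𝟙 Y) (𝟙 Z) ≪≫ a X Y Z ◁ᵢ (Iso.refl f ⊠ᵢ tId Y Z)

def aNat₂ (X : B) {Y Y' : B} (f : Y ⟶ Y') (Z : B) :
    Sq ((X ◂ f) ▸ₜ Z) (a X Y Z) (a X Y' Z) (X ◂ (f ▸ₜ Z)) :=
  aNat (𝟙 X) f (𝟙 Z)

def aNat₃ (X Y : B) {Z Z' : B} (f : Z ⟶ Z') :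
    Sq ((X ⊠ Y) ◂ f) (a X Y Z) (a X Y Z') (X ◂ (Y ◂ f)) :=
  ((tId X Y).symm ⊠ᵢ Iso.refl f) ▷ᵢ a X Y Z' ≪≫ aNat (𝟙 X) (𝟙 Y) f

def aNat'₁ {X X' : B} (f : X ⟶ X') (Y Z : B) :
    Sq (f ▸ₜ (Y ⊠ Z)) (a' X Y Z) (a' X' Y Z) ((f ▸ₜ Y) ▸ₜ Z) :=
  (Iso.refl f ⊠ᵢ (tId Y Z).symm) ▷ᵢ a' X' Y Z ≪≫ aNat' f (𝟙 Y) (𝟙 Z)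

def aNat'₂ (X : B) {Y Y' : B} (f : Y ⟶ Y') (Z : B) :
    Sq (X ◂ (f ▸ₜ Z)) (a' X Y Z) (a' X Y' Z) ((X ◂ f) ▸ₜ Z) :=
  aNat' (𝟙 X) f (𝟙 Z)

def aNat'₃ (X Y : B) {Z Z' : B} (f : Z ⟶ Z') :
    Sq (X ◂ (Y ◂ f)) (a' X Y Z) (a' X Y Z') ((X ⊠ Y) ◂ f) :=
  aNat' (𝟙 X) (𝟙 Y) f ≪≫ a' X Y Z ◁ᵢ (tId X Y ⊠ᵢ Iso.refl f)

/-- Components of the left unitor. -/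
def l (X : B) : I ⊠ X ⟶ X := (CoherenceData.leftUnitor (B := B)).hom.app X

def l' (X : B) : X ⟶ I ⊠ X := (CoherenceData.leftUnitor (B := B)).inv.app X

def lUnit (X : B) : 𝟙 (I ⊠ X) ≅ l X ≫ l' X := modApp (CoherenceData.leftUnitor (B := B)).unit X

def lCounit (X : B) : l' X ≫ l X ≅ 𝟙 X := modApp (CoherenceData.leftUnitor (B := B)).counit X

/-- Pseudonaturality of the left unitor. -/
def lNat {X Y : B} (f : X ⟶ Y) : Sq (I ◂ f) (l X) (l Y) f :=
  (CoherenceData.leftUnitor (B := B)).hom.naturality f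

def lNat' {X Y : B} (f : X ⟶ Y) : Sq f (l' X) (l' Y) (I ◂ f) :=
  (CoherenceData.leftUnitor (B := B)).inv.naturality f

/-- Components of the right unitor. -/
def r (X : B) : X ⊠ I ⟶ X := (CoherenceData.rightUnitor (B := B)).hom.app X

def r' (X : B) : X ⟶ X ⊠ I := (CoherenceData.rightUnitor (B := B)).inv.app X

def rUnit (X : B) : 𝟙 (X ⊠ I) ≅ r X ≫ r' X := modApp (CoherenceData.rightUnitor (B := B)).unit X

def rCounit (X : B) : r' X ≫ r X ≅ 𝟙 X := modApp (CoherenceData.rightUnitor (B := B)).counit X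

/-- Pseudonaturality of the right unitor. -/
def rNat {X Y : B} (f : X ⟶ Y) : Sq (f ▸ₜ I) (r X) (r Y) f :=
  (CoherenceData.rightUnitor (B := B)).hom.naturality f

def rNat' {X Y : B} (f : X ⟶ Y) : Sq f (r' X) (r' Y) (f ▸ₜ I) :=
  (CoherenceData.rightUnitor (B := B)).inv.naturality f

end Components

/-! ### Monoidal bicategories -/

/-- The invertible modifications of a monoidal bicategory. -/
class PentagonatorData (B : Type u) [Bicategory.{w, v} B] extends CoherenceData B where
  /-- the pentagonator -/
  pent (W X Y Z : B) :
    a W X Y ▸ₜ Z ≫ a W (X ⊠ Y) Z ≫ W ◂ a X Y Z ≅ a (W ⊠ X) Y Z ≫ a W X (Y ⊠ Z)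
  pent_modification {W W' X X' Y Y' Z Z' : B} (f : W ⟶ W') (g : X ⟶ X') (h : Y ⟶ Y')
    (k : Z ⟶ Z') :
    IsModification
      (aNat f g h ⊠ₛ Sq.vid k ⊚ aNat f (g ⊠₁ h) k ⊚ Sq.vid f ⊠ₛ aNat g h k)
      (aNat (f ⊠₁ g) h k ⊚ aNat f g (h ⊠₁ k))
      (pent W X Y Z) (pent W' X' Y' Z')
  /-- the middle unit modification -/
  midUnit (X Y : B) : a X I Y ≫ X ◂ l Y ≅ r X ▸ₜ Y
  midUnit_modification {X X' Y Y' : B} (f : X ⟶ X') (g : Y ⟶ Y') :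
    IsModification (aNat f (𝟙 I) g ⊚ Sq.vid f ⊠ₛ lNat g) (rNat f ⊠ₛ Sq.vid g)
      (midUnit X Y) (midUnit X' Y')
  /-- the left unit modification -/
  leftUnit (X Y : B) : l X ▸ₜ Y ≅ a I X Y ≫ l (X ⊠ Y)
  leftUnit_modification {X X' Y Y' : B} (f : X ⟶ X') (g : Y ⟶ Y') :
    IsModification (lNat f ⊠ₛ Sq.vid g) (aNat (𝟙 I) f g ⊚ lNat (f ⊠₁ g))
      (leftUnit X Y) (leftUnit X' Y')
  /-- the right unit modification -/
  rightUnit (X Y : B) : r (X ⊠ Y) ≅ a X Y I ≫ X ◂ r Y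
  rightUnit_modification {X X' Y Y' : B} (f : X ⟶ X') (g : Y ⟶ Y') :
    IsModification (rNat (f ⊠₁ g)) (aNat f g (𝟙 I) ⊚ Sq.vid f ⊠ₛ rNat g)
      (rightUnit X Y) (rightUnit X' Y')

open PentagonatorData

/-- A (fully weak) monoidal bicategory, that is, a tricategory with one object. -/
class MonoidalBicategory (B : Type u) [Bicategory.{w, v} B] extends PentagonatorData B where
  /-- the nonabelian 4-cocycle condition -/
  cocycle (V W X Y Z : B) :
    wR32 (pent V W X Y) Z ▷ᵢ (a V (W ⊠ X ⊠ Y) Z ≫ V ◂ a W (X ⊠ Y) Z ≫ V ◂ W ◂ a X Y Z) ≪⊗≫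
      (a (V ⊠ W) X Y ▸ₜ Z) ◁ᵢ pent V W (X ⊠ Y) Z ▷ᵢ (V ◂ W ◂ a X Y Z) ≪⊗≫
      (a (V ⊠ W) X Y ▸ₜ Z ≫ a (V ⊠ W) (X ⊠ Y) Z) ◁ᵢ (aNat₃ V W (a X Y Z)).symm ≪⊗≫
      pent (V ⊠ W) X Y Z ▷ᵢ a V W (X ⊠ Y ⊠ Z) ≪⊗≫
      Iso.refl (a ((V ⊠ W) ⊠ X) Y Z ≫ a (V ⊠ W) X (Y ⊠ Z) ≫ a V W (X ⊠ Y ⊠ Z)) =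
    Iso.refl _ ≪⊗≫ (a V W X ▸ₜ Y ▸ₜ Z ≫ a V (W ⊠ X) Y ▸ₜ Z) ◁ᵢ aNat₂ V (a W X Y) Z ▷ᵢ
        (V ◂ a W (X ⊠ Y) Z ≫ V ◂ W ◂ a X Y Z) ≪⊗≫
      (a V W X ▸ₜ Y ▸ₜ Z ≫ a V (W ⊠ X) Y ▸ₜ Z ≫ a V ((W ⊠ X) ⊠ Y) Z) ◁ᵢ
        wL32 V (pent W X Y Z) ≪⊗≫
      (a V W X ▸ₜ Y ▸ₜ Z) ◁ᵢ pent V (W ⊠ X) Y Z ▷ᵢ (V ◂ a W X (Y ⊠ Z)) ≪⊗≫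
      aNat₁ (a V W X) Y Z ▷ᵢ (a V (W ⊠ X) (Y ⊠ Z) ≫ V ◂ a W X (Y ⊠ Z)) ≪⊗≫
      a ((V ⊠ W) ⊠ X) Y Z ◁ᵢ pent V W X (Y ⊠ Z)
  /-- the left normalisation condition -/
  normalisation_left (X Y Z : B) :
    pent X I Y Z ▷ᵢ (X ◂ l (Y ⊠ Z)) ≪⊗≫
      a (X ⊠ I) Y Z ◁ᵢ midUnit X (Y ⊠ Z) ≪⊗≫
      (aNat₁ (r X) Y Z).symm ≪⊗≫
      Iso.refl (r X ▸ₜ Y ▸ₜ Z ≫ a X Y Z) =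
    Iso.refl _ ≪⊗≫ (a X I Y ▸ₜ Z ≫ a X (I ⊠ Y) Z) ◁ᵢ wL21 X (leftUnit Y Z).symm ≪⊗≫
      (a X I Y ▸ₜ Z) ◁ᵢ (aNat₂ X (l Y) Z).symm ≪⊗≫
      wR21 (midUnit X Y) Z ▷ᵢ a X Y Z
  /-- the right normalisation condition -/
  normalisation_right (X Y Z : B) :
    pent X Y I Z ▷ᵢ (X ◂ Y ◂ l Z) ≪⊗≫
      a (X ⊠ Y) I Z ◁ᵢ (aNat₃ X Y (l Z)).symm ≪⊗≫
      midUnit (X ⊠ Y) Z ▷ᵢ a X Y Z ≪⊗≫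
      Iso.refl (r (X ⊠ Y) ▸ₜ Z ≫ a X Y Z) =
    Iso.refl _ ≪⊗≫ (a X Y I ▸ₜ Z ≫ a X (Y ⊠ I) Z) ◁ᵢ wL21 X (midUnit Y Z) ≪⊗≫
      (a X Y I ▸ₜ Z) ◁ᵢ (aNat₂ X (r Y) Z).symm ≪⊗≫
      wR21 (rightUnit X Y).symm Z ▷ᵢ a X Y Z

/-! ### Mates of the pentagonator -/

section Mates

variable {B : Type u} [Bicategory.{w, v} B] [PentagonatorData B]

/-- The pentagonator for the inverse associator. -/
def pentInv (W X Y Z : B) :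
    W ◂ a' X Y Z ≫ a' W (X ⊠ Y) Z ≫ a' W X Y ▸ₜ Z ≅ a' W X (Y ⊠ Z) ≫ a' (W ⊠ X) Y Z :=
  Iso.refl _ ≪⊗≫
    (W ◂ a' X Y Z ≫ a' W (X ⊠ Y) Z ≫ a' W X Y ▸ₜ Z) ◁ᵢ aUnit (W ⊠ X) Y Z ≪⊗≫
    (W ◂ a' X Y Z ≫ a' W (X ⊠ Y) Z ≫ a' W X Y ▸ₜ Z ≫ a (W ⊠ X) Y Z) ◁ᵢ
      aUnit W X (Y ⊠ Z) ▷ᵢ a' (W ⊠ X) Y Z ≪⊗≫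
    (W ◂ a' X Y Z ≫ a' W (X ⊠ Y) Z ≫ a' W X Y ▸ₜ Z) ◁ᵢ
      (pent W X Y Z).symm ▷ᵢ (a' W X (Y ⊠ Z) ≫ a' (W ⊠ X) Y Z) ≪⊗≫
    (W ◂ a' X Y Z ≫ a' W (X ⊠ Y) Z) ◁ᵢ wR20 (aCounit W X Y) Z ▷ᵢ
      (a W (X ⊠ Y) Z ≫ W ◂ a X Y Z ≫ a' W X (Y ⊠ Z) ≫ a' (W ⊠ X) Y Z) ≪⊗≫
    (W ◂ a' X Y Z) ◁ᵢ aCounit W (X ⊠ Y) Z ▷ᵢ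
      (W ◂ a X Y Z ≫ a' W X (Y ⊠ Z) ≫ a' (W ⊠ X) Y Z) ≪⊗≫
    wL20 W (aCounit X Y Z) ▷ᵢ (a' W X (Y ⊠ Z) ≫ a' (W ⊠ X) Y Z) ≪⊗≫
    Iso.refl (a' W X (Y ⊠ Z) ≫ a' (W ⊠ X) Y Z)

def pentMate₁ (W X Y Z : B) :
    a W (X ⊠ Y) Z ≫ W ◂ a X Y Z ≅ a' W X Y ▸ₜ Z ≫ a (W ⊠ X) Y Z ≫ a W X (Y ⊠ Z) :=
  Iso.refl _ ≪⊗≫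
    (wR20 (aCounit W X Y) Z).symm ▷ᵢ (a W (X ⊠ Y) Z ≫ W ◂ a X Y Z) ≪⊗≫
    (a' W X Y ▸ₜ Z) ◁ᵢ pent W X Y Z

def pentMate₂ (W X Y Z : B) :
    a' W X Y ▸ₜ Z ≫ a (W ⊠ X) Y Z ≅ a W (X ⊠ Y) Z ≫ W ◂ a X Y Z ≫ a' W X (Y ⊠ Z) :=
  Iso.refl _ ≪⊗≫
    (a' W X Y ▸ₜ Z ≫ a (W ⊠ X) Y Z) ◁ᵢ aUnit W X (Y ⊠ Z) ≪⊗≫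
    (pentMate₁ W X Y Z).symm ▷ᵢ a' W X (Y ⊠ Z) ≪⊗≫
    Iso.refl (a W (X ⊠ Y) Z ≫ W ◂ a X Y Z ≫ a' W X (Y ⊠ Z))

def pentMate₃ (W X Y Z : B) :
    a' W X Y ▸ₜ Z ≫ a (W ⊠ X) Y Z ≫ a W X (Y ⊠ Z) ≫ W ◂ a' X Y Z ≅ a W (X ⊠ Y) Z :=
  Iso.refl _ ≪⊗≫
    (pentMate₁ W X Y Z).symm ▷ᵢ (W ◂ a' X Y Z) ≪⊗≫
    a W (X ⊠ Y) Z ◁ᵢ (wLComp W (a X Y Z) (a' X Y Z)).symm ≪⊗≫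
    a W (X ⊠ Y) Z ◁ᵢ (wLIso W (aUnit X Y Z).symm ≪≫ tId W ((X ⊠ Y) ⊠ Z)) ≪⊗≫
    Iso.refl (a W (X ⊠ Y) Z)

def pentMate₄ (W X Y Z : B) :
    W ◂ a X Y Z ≫ a' W X (Y ⊠ Z) ≫ a' (W ⊠ X) Y Z ≫ a W X Y ▸ₜ Z ≅ a' W (X ⊠ Y) Z :=
  Iso.refl _ ≪⊗≫
    (aCounit W (X ⊠ Y) Z).symm ▷ᵢ
      (W ◂ a X Y Z ≫ a' W X (Y ⊠ Z) ≫ a' (W ⊠ X) Y Z ≫ a W X Y ▸ₜ Z) ≪⊗≫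
    a' W (X ⊠ Y) Z ◁ᵢ pentMate₁ W X Y Z ▷ᵢ
      (a' W X (Y ⊠ Z) ≫ a' (W ⊠ X) Y Z ≫ a W X Y ▸ₜ Z) ≪⊗≫
    (a' W (X ⊠ Y) Z ≫ a' W X Y ▸ₜ Z ≫ a (W ⊠ X) Y Z) ◁ᵢ (aUnit W X (Y ⊠ Z)).symm ▷ᵢ
      (a' (W ⊠ X) Y Z ≫ a W X Y ▸ₜ Z) ≪⊗≫
    (a' W (X ⊠ Y) Z ≫ a' W X Y ▸ₜ Z) ◁ᵢ (aUnit (W ⊠ X) Y Z).symm ▷ᵢ (a W X Y ▸ₜ Z) ≪⊗≫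
    a' W (X ⊠ Y) Z ◁ᵢ wR20 (aCounit W X Y) Z ≪⊗≫
    Iso.refl (a' W (X ⊠ Y) Z)

def pentMate₅ (W X Y Z : B) :
    a W X (Y ⊠ Z) ≫ W ◂ a' X Y Z ≅ a' (W ⊠ X) Y Z ≫ a W X Y ▸ₜ Z ≫ a W (X ⊠ Y) Z :=
  Iso.refl _ ≪⊗≫
    (aCounit (W ⊠ X) Y Z).symm ▷ᵢ (a W X (Y ⊠ Z) ≫ W ◂ a' X Y Z) ≪⊗≫
    a' (W ⊠ X) Y Z ◁ᵢ (pent W X Y Z).symm ▷ᵢ (W ◂ a' X Y Z) ≪⊗≫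
    (a' (W ⊠ X) Y Z ≫ a W X Y ▸ₜ Z ≫ a W (X ⊠ Y) Z) ◁ᵢ
      ((wLComp W (a X Y Z) (a' X Y Z)).symm ≪≫ wLIso W (aUnit X Y Z).symm ≪≫
        tId W ((X ⊠ Y) ⊠ Z)) ≪⊗≫
    Iso.refl (a' (W ⊠ X) Y Z ≫ a W X Y ▸ₜ Z ≫ a W (X ⊠ Y) Z)

end Mates

/-! ### Braidings and symmetries -/

/-- A braiding on a monoidal bicategory: an adjoint equivalence in the bicategory of
pseudofunctors. -/
class BraidingData (B : Type u) [Bicategory.{w, v} B] extends MonoidalBicategory B where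
  /-- the braiding -/
  braiding : TensorBicategory.tensor (B := B) ≌ swapTensor B

section BraidingComponents

variable {B : Type u} [Bicategory.{w, v} B] [BraidingData B]

/-- Components of the braiding. -/
def b (X Y : B) : X ⊠ Y ⟶ Y ⊠ X := (BraidingData.braiding (B := B)).hom.app (X, Y)

def b' (X Y : B) : Y ⊠ X ⟶ X ⊠ Y := (BraidingData.braiding (B := B)).inv.app (X, Y)

def bUnit (X Y : B) : 𝟙 (X ⊠ Y) ≅ b X Y ≫ b' X Y :=
  modApp (BraidingData.braiding (B := B)).unit (X, Y)

def bCounit (X Y : B) : b' X Y ≫ b X Y ≅ 𝟙 (Y ⊠ X) :=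
  modApp (BraidingData.braiding (B := B)).counit (X, Y)

/-- Pseudonaturality of the braiding. -/
def bNat {X X' Y Y' : B} (f : X ⟶ X') (g : Y ⟶ Y') :
    Sq (f ⊠₁ g) (b X Y) (b X' Y') (g ⊠₁ f) :=
  (BraidingData.braiding (B := B)).hom.naturality (a := (X, Y)) (b := (X', Y')) (f, g)

def bNat' {X X' Y Y' : B} (f : X ⟶ X') (g : Y ⟶ Y') :
    Sq (g ⊠₁ f) (b' X Y) (b' X' Y') (f ⊠₁ g) :=
  (BraidingData.braiding (B := B)).inv.naturality (a := (X, Y)) (b := (X', Y')) (f, g)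

def bNat₁ {X X' : B} (f : X ⟶ X') (Y : B) : Sq (f ▸ₜ Y) (b X Y) (b X' Y) (Y ◂ f) :=
  bNat f (𝟙 Y)

def bNat₂ (X : B) {Y Y' : B} (g : Y ⟶ Y') : Sq (X ◂ g) (b X Y) (b X Y') (g ▸ₜ X) :=
  bNat (𝟙 X) g

end BraidingComponents

/-- The two hexagonators of a braided monoidal bicategory. -/
class HexagonatorData (B : Type u) [Bicategory.{w, v} B] extends BraidingData B where
  /-- the hexagonator for moving one object past a product -/
  hexR (X Y Z : B) :
    b X Y ▸ₜ Z ≫ a Y X Z ≫ Y ◂ b X Z ≅ a X Y Z ≫ b X (Y ⊠ Z) ≫ a Y Z X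
  hexR_modification {X X' Y Y' Z Z' : B} (f : X ⟶ X') (g : Y ⟶ Y') (h : Z ⟶ Z') :
    IsModification
      (bNat f g ⊠ₛ Sq.vid h ⊚ aNat g f h ⊚ Sq.vid g ⊠ₛ bNat f h)
      (aNat f g h ⊚ bNat f (g ⊠₁ h) ⊚ aNat g h f)
      (hexR X Y Z) (hexR X' Y' Z')
  /-- the hexagonator for moving a product past one object -/
  hexS (X Y Z : B) :
    X ◂ b Y Z ≫ a' X Z Y ≫ b X Z ▸ₜ Y ≅ a' X Y Z ≫ b (X ⊠ Y) Z ≫ a' Z X Y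
  hexS_modification {X X' Y Y' Z Z' : B} (f : X ⟶ X') (g : Y ⟶ Y') (h : Z ⟶ Z') :
    IsModification
      (Sq.vid f ⊠ₛ bNat g h ⊚ aNat' f h g ⊚ bNat f h ⊠ₛ Sq.vid g)
      (aNat' f g h ⊚ bNat (f ⊠₁ g) h ⊚ aNat' h f g)
      (hexS X Y Z) (hexS X' Y' Z')

open HexagonatorData

/-- A braided monoidal bicategory. -/
class BraidedMonoidalBicategory (B : Type u) [Bicategory.{w, v} B]
    extends HexagonatorData B where
  /-- moving one object past a product of three -/
  braid_one_three (W X Y Z : B) :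
    wR33 (hexR W X Y) Z ▷ᵢ (a X (Y ⊠ W) Z ≫ X ◂ a Y W Z ≫ X ◂ Y ◂ b W Z) ≪⊗≫
      (a W X Y ▸ₜ Z ≫ b W (X ⊠ Y) ▸ₜ Z) ◁ᵢ pent X Y W Z ▷ᵢ (X ◂ Y ◂ b W Z) ≪⊗≫
      (a W X Y ▸ₜ Z ≫ b W (X ⊠ Y) ▸ₜ Z ≫ a (X ⊠ Y) W Z) ◁ᵢ (aNat₃ X Y (b W Z)).symm ≪⊗≫
      (a W X Y ▸ₜ Z) ◁ᵢ hexR W (X ⊠ Y) Z ▷ᵢ a X Y (Z ⊠ W) ≪⊗≫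
      (a W X Y ▸ₜ Z ≫ a W (X ⊠ Y) Z ≫ b W ((X ⊠ Y) ⊠ Z)) ◁ᵢ (pent X Y Z W).symm ≪⊗≫
      (a W X Y ▸ₜ Z ≫ a W (X ⊠ Y) Z) ◁ᵢ (bNat₂ W (a X Y Z)).symm ▷ᵢ
        (a X (Y ⊠ Z) W ≫ X ◂ a Y Z W) ≪⊗≫
      pent W X Y Z ▷ᵢ (b W (X ⊠ Y ⊠ Z) ≫ a X (Y ⊠ Z) W ≫ X ◂ a Y Z W) ≪⊗≫
      Iso.refl (a (W ⊠ X) Y Z ≫ a W X (Y ⊠ Z) ≫ b W (X ⊠ Y ⊠ Z) ≫ a X (Y ⊠ Z) W ≫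
        X ◂ a Y Z W) =
    Iso.refl _ ≪⊗≫
      (b W X ▸ₜ Y ▸ₜ Z ≫ a X W Y ▸ₜ Z) ◁ᵢ aNat₂ X (b W Y) Z ▷ᵢ
        (X ◂ a Y W Z ≫ X ◂ Y ◂ b W Z) ≪⊗≫
      (b W X ▸ₜ Y ▸ₜ Z ≫ a X W Y ▸ₜ Z ≫ a X (W ⊠ Y) Z) ◁ᵢ wL33 X (hexR W Y Z) ≪⊗≫
      (b W X ▸ₜ Y ▸ₜ Z) ◁ᵢ pent X W Y Z ▷ᵢ (X ◂ b W (Y ⊠ Z) ≫ X ◂ a Y Z W) ≪⊗≫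
      aNat₁ (b W X) Y Z ▷ᵢ (a X W (Y ⊠ Z) ≫ X ◂ b W (Y ⊠ Z) ≫ X ◂ a Y Z W) ≪⊗≫
      a (W ⊠ X) Y Z ◁ᵢ hexR W X (Y ⊠ Z) ▷ᵢ (X ◂ a Y Z W) ≪⊗≫
      Iso.refl (a (W ⊠ X) Y Z ≫ a W X (Y ⊠ Z) ≫ b W (X ⊠ Y ⊠ Z) ≫ a X (Y ⊠ Z) W ≫
        X ◂ a Y Z W)
  /-- moving a product of three past one object -/
  braid_three_one (W X Y Z : B) :
    wL33 W (hexS X Y Z) ▷ᵢ (a' W (Z ⊠ X) Y ≫ a' W Z X ▸ₜ Y ≫ b W Z ▸ₜ X ▸ₜ Y) ≪⊗≫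
      (W ◂ a' X Y Z ≫ W ◂ b (X ⊠ Y) Z) ◁ᵢ pentInv W Z X Y ▷ᵢ (b W Z ▸ₜ X ▸ₜ Y) ≪⊗≫
      (W ◂ a' X Y Z ≫ W ◂ b (X ⊠ Y) Z ≫ a' W Z (X ⊠ Y)) ◁ᵢ (aNat'₁ (b W Z) X Y).symm ≪⊗≫
      (W ◂ a' X Y Z) ◁ᵢ hexS W (X ⊠ Y) Z ▷ᵢ a' (Z ⊠ W) X Y ≪⊗≫
      (W ◂ a' X Y Z ≫ a' W (X ⊠ Y) Z ≫ b (W ⊠ (X ⊠ Y)) Z) ◁ᵢ (pentInv Z W X Y).symm ≪⊗≫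
      (W ◂ a' X Y Z ≫ a' W (X ⊠ Y) Z) ◁ᵢ (bNat₁ (a' W X Y) Z).symm ▷ᵢ
        (a' Z (W ⊠ X) Y ≫ a' Z W X ▸ₜ Y) ≪⊗≫
      pentInv W X Y Z ▷ᵢ (b ((W ⊠ X) ⊠ Y) Z ≫ a' Z (W ⊠ X) Y ≫ a' Z W X ▸ₜ Y) ≪⊗≫
      Iso.refl (a' W X (Y ⊠ Z) ≫ a' (W ⊠ X) Y Z ≫ b ((W ⊠ X) ⊠ Y) Z ≫ a' Z (W ⊠ X) Y ≫
        a' Z W X ▸ₜ Y) =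
    Iso.refl _ ≪⊗≫
      (W ◂ X ◂ b Y Z ≫ W ◂ a' X Z Y) ◁ᵢ aNat'₂ W (b X Z) Y ▷ᵢ
        (a' W Z X ▸ₜ Y ≫ b W Z ▸ₜ X ▸ₜ Y) ≪⊗≫
      (W ◂ X ◂ b Y Z ≫ W ◂ a' X Z Y ≫ a' W (X ⊠ Z) Y) ◁ᵢ wR33 (hexS W X Z) Y ≪⊗≫
      (W ◂ X ◂ b Y Z) ◁ᵢ pentInv W X Z Y ▷ᵢ (b (W ⊠ X) Z ▸ₜ Y ≫ a' Z W X ▸ₜ Y) ≪⊗≫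
      aNat'₃ W X (b Y Z) ▷ᵢ (a' (W ⊠ X) Z Y ≫ b (W ⊠ X) Z ▸ₜ Y ≫ a' Z W X ▸ₜ Y) ≪⊗≫
      a' W X (Y ⊠ Z) ◁ᵢ hexS (W ⊠ X) Y Z ▷ᵢ (a' Z W X ▸ₜ Y) ≪⊗≫
      Iso.refl (a' W X (Y ⊠ Z) ≫ a' (W ⊠ X) Y Z ≫ b ((W ⊠ X) ⊠ Y) Z ≫ a' Z (W ⊠ X) Y ≫
        a' Z W X ▸ₜ Y)
  /-- moving a product of two past a product of two -/
  braid_two_two (W X Y Z : B) :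
    wR33 (hexS W X Y) Z ▷ᵢ
        (a (Y ⊠ W) X Z ≫ (Y ⊠ W) ◂ b X Z ≫ a Y W (Z ⊠ X) ≫ Y ◂ a' W Z X ≫
          Y ◂ (b W Z ▸ₜ X)) ≪⊗≫
      (a' W X Y ▸ₜ Z ≫ b (W ⊠ X) Y ▸ₜ Z ≫ a' Y W X ▸ₜ Z ≫ a (Y ⊠ W) X Z) ◁ᵢ
        aNat₃ Y W (b X Z) ▷ᵢ (Y ◂ a' W Z X ≫ Y ◂ (b W Z ▸ₜ X)) ≪⊗≫
      (a' W X Y ▸ₜ Z ≫ b (W ⊠ X) Y ▸ₜ Z ≫ a' Y W X ▸ₜ Z ≫ a (Y ⊠ W) X Z ≫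
        a Y W (X ⊠ Z)) ◁ᵢ wL33 Y (hexS W X Z) ≪⊗≫
      (a' W X Y ▸ₜ Z ≫ b (W ⊠ X) Y ▸ₜ Z) ◁ᵢ pentMate₃ Y W X Z ▷ᵢ
        (Y ◂ b (W ⊠ X) Z ≫ Y ◂ a' Z W X) ≪⊗≫
      (a' W X Y ▸ₜ Z) ◁ᵢ hexR (W ⊠ X) Y Z ▷ᵢ (Y ◂ a' Z W X) ≪⊗≫
      Iso.refl (a' W X Y ▸ₜ Z ≫ a (W ⊠ X) Y Z ≫ b (W ⊠ X) (Y ⊠ Z) ≫ a Y Z (W ⊠ X) ≫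
        Y ◂ a' Z W X) =
    Iso.refl _ ≪⊗≫
      ((W ◂ b X Y) ▸ₜ Z ≫ a' W Y X ▸ₜ Z) ◁ᵢ aNat₁ (b W Y) X Z ▷ᵢ
        ((Y ⊠ W) ◂ b X Z ≫ a Y W (Z ⊠ X) ≫ Y ◂ a' W Z X ≫ Y ◂ (b W Z ▸ₜ X)) ≪⊗≫
      ((W ◂ b X Y) ▸ₜ Z ≫ a' W Y X ▸ₜ Z ≫ a (W ⊠ Y) X Z) ◁ᵢ interchange (b W Y) (b X Z) ▷ᵢ
        (a Y W (Z ⊠ X) ≫ Y ◂ a' W Z X ≫ Y ◂ (b W Z ▸ₜ X)) ≪⊗≫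
      ((W ◂ b X Y) ▸ₜ Z) ◁ᵢ pentMate₂ W Y X Z ▷ᵢ
        ((W ⊠ Y) ◂ b X Z ≫ b W Y ▸ₜ (Z ⊠ X) ≫ a Y W (Z ⊠ X) ≫ Y ◂ a' W Z X ≫
          Y ◂ (b W Z ▸ₜ X)) ≪⊗≫
      aNat₂ W (b X Y) Z ▷ᵢ
        (W ◂ a Y X Z ≫ a' W Y (X ⊠ Z) ≫ (W ⊠ Y) ◂ b X Z ≫ b W Y ▸ₜ (Z ⊠ X) ≫
          a Y W (Z ⊠ X) ≫ Y ◂ a' W Z X ≫ Y ◂ (b W Z ▸ₜ X)) ≪⊗≫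
      (a W (X ⊠ Y) Z ≫ W ◂ (b X Y ▸ₜ Z) ≫ W ◂ a Y X Z) ◁ᵢ (aNat'₃ W Y (b X Z)).symm ▷ᵢ
        (b W Y ▸ₜ (Z ⊠ X) ≫ a Y W (Z ⊠ X) ≫ Y ◂ a' W Z X ≫ Y ◂ (b W Z ▸ₜ X)) ≪⊗≫
      a W (X ⊠ Y) Z ◁ᵢ wL33 W (hexR X Y Z) ▷ᵢ
        (a' W Y (Z ⊠ X) ≫ b W Y ▸ₜ (Z ⊠ X) ≫ a Y W (Z ⊠ X) ≫ Y ◂ a' W Z X ≫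
          Y ◂ (b W Z ▸ₜ X)) ≪⊗≫
      (a W (X ⊠ Y) Z ≫ W ◂ a X Y Z ≫ W ◂ b X (Y ⊠ Z) ≫ W ◂ a Y Z X ≫ a' W Y (Z ⊠ X) ≫
        b W Y ▸ₜ (Z ⊠ X)) ◁ᵢ pentMate₅ Y W Z X ▷ᵢ (Y ◂ (b W Z ▸ₜ X)) ≪⊗≫
      (a W (X ⊠ Y) Z ≫ W ◂ a X Y Z ≫ W ◂ b X (Y ⊠ Z) ≫ W ◂ a Y Z X ≫ a' W Y (Z ⊠ X)) ◁ᵢ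
        aNat'₁ (b W Y) Z X ▷ᵢ (a Y W Z ▸ₜ X ≫ a Y (W ⊠ Z) X ≫ Y ◂ (b W Z ▸ₜ X)) ≪⊗≫
      (a W (X ⊠ Y) Z ≫ W ◂ a X Y Z ≫ W ◂ b X (Y ⊠ Z) ≫ W ◂ a Y Z X ≫ a' W Y (Z ⊠ X) ≫
        a' (W ⊠ Y) Z X ≫ b W Y ▸ₜ Z ▸ₜ X ≫ a Y W Z ▸ₜ X) ◁ᵢ
        (aNat₂ Y (b W Z) X).symm ≪⊗≫
      (a W (X ⊠ Y) Z ≫ W ◂ a X Y Z ≫ W ◂ b X (Y ⊠ Z) ≫ W ◂ a Y Z X ≫ a' W Y (Z ⊠ X) ≫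
        a' (W ⊠ Y) Z X) ◁ᵢ wR33 (hexR W Y Z) X ▷ᵢ a Y (Z ⊠ W) X ≪⊗≫
      (a W (X ⊠ Y) Z ≫ W ◂ a X Y Z ≫ W ◂ b X (Y ⊠ Z)) ◁ᵢ pentMate₄ W Y Z X ▷ᵢ
        (b W (Y ⊠ Z) ▸ₜ X ≫ a Y Z W ▸ₜ X ≫ a Y (Z ⊠ W) X) ≪⊗≫
      (a W (X ⊠ Y) Z ≫ W ◂ a X Y Z) ◁ᵢ hexS W X (Y ⊠ Z) ▷ᵢ
        (a Y Z W ▸ₜ X ≫ a Y (Z ⊠ W) X) ≪⊗≫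
      (a W (X ⊠ Y) Z ≫ W ◂ a X Y Z ≫ a' W X (Y ⊠ Z) ≫ b (W ⊠ X) (Y ⊠ Z)) ◁ᵢ
        (pentMate₅ Y Z W X).symm ≪⊗≫
      (pentMate₂ W X Y Z).symm ▷ᵢ (b (W ⊠ X) (Y ⊠ Z) ≫ a Y Z (W ⊠ X) ≫ Y ◂ a' Z W X) ≪⊗≫
      Iso.refl (a' W X Y ▸ₜ Z ≫ a (W ⊠ X) Y Z ≫ b (W ⊠ X) (Y ⊠ Z) ≫ a Y Z (W ⊠ X) ≫
        Y ◂ a' Z W X)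
  /-- the two fillings of the Yang-Baxter hexagon agree -/
  yang_baxter (X Y Z : B) :
    hexR X Y Z ▷ᵢ (a' Y Z X ≫ b Y Z ▸ₜ X) ≪⊗≫
      (a X Y Z ≫ b X (Y ⊠ Z)) ◁ᵢ (aUnit Y Z X).symm ▷ᵢ (b Y Z ▸ₜ X) ≪⊗≫
      a X Y Z ◁ᵢ (bNat₂ X (b Y Z)).symm ≪⊗≫
      (a X Y Z ≫ X ◂ b Y Z) ◁ᵢ (aCounit X Z Y).symm ▷ᵢ b X (Z ⊠ Y) ≪⊗≫
      (a X Y Z ≫ X ◂ b Y Z ≫ a' X Z Y ≫ a X Z Y ≫ b X (Z ⊠ Y)) ◁ᵢ aUnit Z Y X ≪⊗≫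
      (a X Y Z ≫ X ◂ b Y Z ≫ a' X Z Y) ◁ᵢ (hexR X Z Y).symm ▷ᵢ a' Z Y X ≪⊗≫
      Iso.refl (a X Y Z ≫ X ◂ b Y Z ≫ a' X Z Y ≫ b X Z ▸ₜ Y ≫ a Z X Y ≫ Z ◂ b X Y ≫
        a' Z Y X) =
    Iso.refl _ ≪⊗≫
      (b X Y ▸ₜ Z ≫ a Y X Z) ◁ᵢ hexS Y X Z ≪⊗≫
      (b X Y ▸ₜ Z) ◁ᵢ (aUnit Y X Z).symm ▷ᵢ (b (Y ⊠ X) Z ≫ a' Z Y X) ≪⊗≫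
      bNat₁ (b X Y) Z ▷ᵢ a' Z Y X ≪⊗≫
      aUnit X Y Z ▷ᵢ (b (X ⊠ Y) Z ≫ Z ◂ b X Y ≫ a' Z Y X) ≪⊗≫
      (a X Y Z ≫ a' X Y Z ≫ b (X ⊠ Y) Z) ◁ᵢ (aCounit Z X Y).symm ▷ᵢ
        (Z ◂ b X Y ≫ a' Z Y X) ≪⊗≫
      a X Y Z ◁ᵢ (hexS X Y Z).symm ▷ᵢ (a Z X Y ≫ Z ◂ b X Y ≫ a' Z Y X) ≪⊗≫
      Iso.refl (a X Y Z ≫ X ◂ b Y Z ≫ a' X Z Y ≫ b X Z ▸ₜ Y ≫ a Z X Y ≫ Z ◂ b X Y ≫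
        a' Z Y X)

/-- A sylleptic monoidal bicategory. -/
class SyllepticMonoidalBicategory (B : Type u) [Bicategory.{w, v} B]
    extends BraidedMonoidalBicategory B where
  /-- the syllepsis -/
  syl (X Y : B) : 𝟙 (X ⊠ Y) ≅ b X Y ≫ b Y X
  syl_modification {X X' Y Y' : B} (f : X ⟶ X') (g : Y ⟶ Y') :
    IsModification (Sq.vid (f ⊠₁ g)) (bNat f g ⊚ bNat g f) (syl X Y) (syl X' Y')
  /-- syllepsis for one object and a product of two -/
  syl_one_two (X Y Z : B) :
    hexR X Y Z ▷ᵢ (Y ◂ b Z X ≫ a' Y X Z ≫ b Y X ▸ₜ Z) ≪⊗≫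
      (a X Y Z ≫ b X (Y ⊠ Z) ≫ a Y Z X) ◁ᵢ hexS Y Z X ≪⊗≫
      (a X Y Z ≫ b X (Y ⊠ Z)) ◁ᵢ (aUnit Y Z X).symm ▷ᵢ (b (Y ⊠ Z) X ≫ a' X Y Z) ≪⊗≫
      a X Y Z ◁ᵢ (syl X (Y ⊠ Z)).symm ▷ᵢ a' X Y Z ≪⊗≫
      (aUnit X Y Z).symm ≪⊗≫ Iso.refl (𝟙 ((X ⊠ Y) ⊠ Z)) =
    Iso.refl _ ≪⊗≫
      (b X Y ▸ₜ Z ≫ a Y X Z) ◁ᵢ wL20 Y (syl X Z).symm ▷ᵢ (a' Y X Z ≫ b Y X ▸ₜ Z) ≪⊗≫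
      (b X Y ▸ₜ Z) ◁ᵢ (aUnit Y X Z).symm ▷ᵢ (b Y X ▸ₜ Z) ≪⊗≫
      wR20 (syl X Y).symm Z ≪⊗≫ Iso.refl (𝟙 ((X ⊠ Y) ⊠ Z))
  /-- syllepsis for a product of two and one object -/
  syl_two_one (X Y Z : B) :
    hexS X Y Z ▷ᵢ (b Z X ▸ₜ Y ≫ a X Z Y ≫ X ◂ b Z Y) ≪⊗≫
      (a' X Y Z ≫ b (X ⊠ Y) Z ≫ a' Z X Y) ◁ᵢ hexR Z X Y ≪⊗≫
      (a' X Y Z ≫ b (X ⊠ Y) Z) ◁ᵢ aCounit Z X Y ▷ᵢ (b Z (X ⊠ Y) ≫ a X Y Z) ≪⊗≫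
      a' X Y Z ◁ᵢ (syl (X ⊠ Y) Z).symm ▷ᵢ a X Y Z ≪⊗≫
      aCounit X Y Z ≪⊗≫ Iso.refl (𝟙 (X ⊠ Y ⊠ Z)) =
    Iso.refl _ ≪⊗≫
      (X ◂ b Y Z ≫ a' X Z Y) ◁ᵢ wR20 (syl X Z).symm Y ▷ᵢ (a X Z Y ≫ X ◂ b Z Y) ≪⊗≫
      (X ◂ b Y Z) ◁ᵢ aCounit X Z Y ▷ᵢ (X ◂ b Z Y) ≪⊗≫
      wL20 X (syl Y Z).symm ≪⊗≫ Iso.refl (𝟙 (X ⊠ Y ⊠ Z))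

open SyllepticMonoidalBicategory

/-- A symmetric monoidal bicategory. -/
class SymmetricMonoidalBicategory (B : Type u) [Bicategory.{w, v} B]
    extends SyllepticMonoidalBicategory B where
  /-- the two ways of inserting a syllepsis next to a braiding agree -/
  symmetry (X Y : B) :
    Iso.refl (b X Y) ≪⊗≫ syl X Y ▷ᵢ b X Y ≪⊗≫ Iso.refl (b X Y ≫ b Y X ≫ b X Y) =
    Iso.refl (b X Y) ≪⊗≫ b X Y ◁ᵢ syl Y X ≪⊗≫ Iso.refl (b X Y ≫ b Y X ≫ b X Y)

/-! ### Reversal of 2-cells -/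

/-- A reversal of 2-cells on a bicategory: an involution which is the identity on objects and on
1-cells, reverses the direction of 2-cells, and preserves the bicategory structure. -/
class DaggerBicategory (B : Type u) [Bicategory.{w, v} B] where
  /-- the reversal of a 2-cell -/
  dag {X Y : B} {f g : X ⟶ Y} (η : f ⟶ g) : g ⟶ f
  dag_dag {X Y : B} {f g : X ⟶ Y} (η : f ⟶ g) : dag (dag η) = η
  dag_id {X Y : B} (f : X ⟶ Y) : dag (𝟙 f) = 𝟙 f
  dag_comp {X Y : B} {f g h : X ⟶ Y} (η : f ⟶ g) (θ : g ⟶ h) : dag (η ≫ θ) = dag θ ≫ dag η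
  dag_whiskerLeft {X Y Z : B} (f : X ⟶ Y) {g h : Y ⟶ Z} (η : g ⟶ h) :
    dag (f ◁ η) = f ◁ dag η
  dag_whiskerRight {X Y Z : B} {f g : X ⟶ Y} (η : f ⟶ g) (h : Y ⟶ Z) :
    dag (η ▷ h) = dag η ▷ h
  dag_associator {W X Y Z : B} (f : W ⟶ X) (g : X ⟶ Y) (h : Y ⟶ Z) :
    dag (α_ f g h).hom = (α_ f g h).inv
  dag_leftUnitor {X Y : B} (f : X ⟶ Y) : dag (λ_ f).hom = (λ_ f).inv
  dag_rightUnitor {X Y : B} (f : X ⟶ Y) : dag (ρ_ f).hom = (ρ_ f).inv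

/-- An invertible 2-cell is unitary when its reversal is its inverse. -/
def IsUnitary {B : Type u} [Bicategory.{w, v} B] [DaggerBicategory B] {X Y : B} {f g : X ⟶ Y}
    (e : f ≅ g) : Prop :=
  DaggerBicategory.dag e.hom = e.inv

/-- A symmetric monoidal bicategory with a reversal of 2-cells that preserves the tensor product
and all the structural 2-cells. -/
class SymmetricMonoidalDaggerBicategory (B : Type u) [Bicategory.{w, v} B]
    extends SymmetricMonoidalBicategory B, DaggerBicategory B where
  dag_tensor {X X' Y Y' : B} {f f' : X ⟶ X'} {g g' : Y ⟶ Y'} (η : f ⟶ f') (θ : g ⟶ g') :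
    dag (tMap₂ η θ) = tMap₂ (dag η) (dag θ)
  unitary_tComp {X X' X'' Y Y' Y'' : B} (f : X ⟶ X') (f' : X' ⟶ X'') (g : Y ⟶ Y')
    (g' : Y' ⟶ Y'') : IsUnitary (tComp f f' g g')
  unitary_tId (X Y : B) : IsUnitary (tId X Y)
  unitary_aNat {X X' Y Y' Z Z' : B} (f : X ⟶ X') (g : Y ⟶ Y') (h : Z ⟶ Z') :
    IsUnitary (aNat f g h)
  unitary_aNat' {X X' Y Y' Z Z' : B} (f : X ⟶ X') (g : Y ⟶ Y') (h : Z ⟶ Z') :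
    IsUnitary (aNat' f g h)
  unitary_aUnit (X Y Z : B) : IsUnitary (aUnit X Y Z)
  unitary_aCounit (X Y Z : B) : IsUnitary (aCounit X Y Z)
  unitary_lNat {X Y : B} (f : X ⟶ Y) : IsUnitary (lNat f)
  unitary_lNat' {X Y : B} (f : X ⟶ Y) : IsUnitary (lNat' f)
  unitary_lUnit (X : B) : IsUnitary (lUnit X)
  unitary_lCounit (X : B) : IsUnitary (lCounit X)
  unitary_rNat {X Y : B} (f : X ⟶ Y) : IsUnitary (rNat f)
  unitary_rNat' {X Y : B} (f : X ⟶ Y) : IsUnitary (rNat' f)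
  unitary_rUnit (X : B) : IsUnitary (rUnit X)
  unitary_rCounit (X : B) : IsUnitary (rCounit X)
  unitary_pent (W X Y Z : B) : IsUnitary (pent W X Y Z)
  unitary_midUnit (X Y : B) : IsUnitary (midUnit X Y)
  unitary_leftUnit (X Y : B) : IsUnitary (leftUnit X Y)
  unitary_rightUnit (X Y : B) : IsUnitary (rightUnit X Y)
  unitary_bNat {X X' Y Y' : B} (f : X ⟶ X') (g : Y ⟶ Y') : IsUnitary (bNat f g)
  unitary_bNat' {X X' Y Y' : B} (f : X ⟶ X') (g : Y ⟶ Y') : IsUnitary (bNat' f g)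
  unitary_bUnit (X Y : B) : IsUnitary (bUnit X Y)
  unitary_bCounit (X Y : B) : IsUnitary (bCounit X Y)
  unitary_hexR (X Y Z : B) : IsUnitary (hexR X Y Z)
  unitary_hexS (X Y Z : B) : IsUnitary (hexS X Y Z)
  unitary_syl (X Y : B) : IsUnitary (syl X Y)

/-! ### Scalars -/

/-- The scalars: endomorphisms of the unit object, a monoidal category under composition. -/
abbrev Scalars (B : Type u) [Bicategory.{w, v} B] [CoherenceData B] : Type v := (I : B) ⟶ I

section Scalars

variable {B : Type u} [Bicategory.{w, v} B] [PentagonatorData B]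

/-- The structural 2-cell between the two unitors at the unit object. -/
def unitorComparison : l (I : B) ≅ r (I : B) :=
  cancelLeft (rCounit ((I : B) ⊠ I))
    ((rNat (l I)).symm ≪≫
      (leftUnit I I ≪≫ a I I I ◁ᵢ (cancelRight (lUnit I) (lNat (l I))).symm ≪≫ midUnit I I) ▷ᵢ
        r I ≪≫
      rNat (r I))

/-- A scalar on the left tensor factor slides through `l I`. -/
def slide (T : Scalars B) : T ▸ₜ I ≫ l I ≅ l I ≫ T :=
  (T ▸ₜ I) ◁ᵢ unitorComparison ≪≫ rNat T ≪≫ unitorComparison.symm ▷ᵢ T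

/-- The crossing of two scalars after the equivalence `l I : I ⊠ I ⟶ I`: `S` is moved to the right
tensor factor and `T` to the left one, where they slide past each other by interchange. -/
def crossing (S T : Scalars B) : l I ≫ S ≫ T ≅ l I ≫ T ≫ S :=
  (α_ (l I) S T).symm ≪≫ (lNat S).symm ▷ᵢ T ≪≫ α_ (I ◂ S) (l I) T ≪≫
    (I ◂ S) ◁ᵢ (slide T).symm ≪≫ (α_ (I ◂ S) (T ▸ₜ I) (l I)).symm ≪≫
    (interchange T S).symm ▷ᵢ l I ≪≫
    α_ (T ▸ₜ I) (I ◂ S) (l I) ≪≫ (T ▸ₜ I) ◁ᵢ lNat S ≪≫ (α_ (T ▸ₜ I) (l I) S).symm ≪≫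
    slide T ▷ᵢ S ≪≫ α_ (l I) T S

/-- The crossing of two scalars. -/
def scalarBraiding (S T : Scalars B) : S ≫ T ≅ T ≫ S :=
  cancelLeft (lCounit I) (crossing S T)

end Scalars

/-! ### Witnesses -/

open DaggerBicategory

/-- The multiplication of a pair of 1-cells `I ⟶ A ⟶ I` induced by a comparison 2-cell. -/
def mulOfCompare {B : Type u} [Bicategory.{w, v} B] {U A : B} {into : U ⟶ A} {out : A ⟶ U}
    (compare : out ≫ into ⟶ 𝟙 A) : (into ≫ out) ≫ (into ≫ out) ⟶ into ≫ out :=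
  (α_ into out (into ≫ out)).hom ≫
    into ◁ ((α_ out into out).inv ≫ compare ▷ out ≫ (λ_ out).hom)

/-- Witnesses for an object `A`. -/
structure Witness {B : Type u} [Bicategory.{w, v} B] [SymmetricMonoidalDaggerBicategory B]
    (A : B) where
  /-- the 1-cell from the unit object to `A` -/
  into : (I : B) ⟶ A
  /-- the 1-cell from `A` to the unit object -/
  out : A ⟶ (I : B)
  /-- create uniform classical data -/
  create : 𝟙 (I : B) ⟶ into ≫ out
  /-- compare classical data -/
  compare : out ≫ into ⟶ 𝟙 A
  /-- delete classical data -/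
  delete : into ≫ out ⟶ 𝟙 (I : B) := dag create
  /-- copy classical data -/
  copy : 𝟙 A ⟶ out ≫ into := dag compare
  delete_eq : delete = dag create := by rfl
  copy_eq : copy = dag compare := by rfl
  yank₁ : rightZigzag create compare = (ρ_ out).hom ≫ (λ_ out).inv
  yank₂ : leftZigzag copy delete = (λ_ out).hom ≫ (ρ_ out).inv
  yank₃ : leftZigzag create compare = (λ_ into).hom ≫ (ρ_ into).inv
  yank₄ : rightZigzag copy delete = (ρ_ into).hom ≫ (λ_ into).inv
  /-- copying followed by comparing is the identity -/
  copy_compare : copy ≫ compare = 𝟙 (𝟙 A)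
  /-- comparison is unchanged when the two systems are swapped -/
  commutes :
    (scalarBraiding (into ≫ out) (into ≫ out)).hom ≫ mulOfCompare compare = mulOfCompare compare

namespace Witness

variable {B : Type u} [Bicategory.{w, v} B] [SymmetricMonoidalDaggerBicategory B] {A : B}

/-- The scalar `I ⟶ A ⟶ I` of a witness. -/
def scalar (W : Witness A) : Scalars B := W.into ≫ W.out

/-- The multiplication: compare the classical data of two copies of the witnessing system. -/
def mul (W : Witness A) : W.scalar ≫ W.scalar ⟶ W.scalar := mulOfCompare W.compare

/-- The unit: create uniform classical data. -/
def one (W : Witness A) : 𝟙 (I : B) ⟶ W.scalar := W.create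

end Witness

/-! ### Classical structures -/

/-- A dagger on a category. -/
class DaggerCategory (C : Type u) [Category.{v} C] where
  /-- the dagger of a morphism -/
  dagger {X Y : C} (f : X ⟶ Y) : Y ⟶ X
  dagger_dagger {X Y : C} (f : X ⟶ Y) : dagger (dagger f) = f
  dagger_id (X : C) : dagger (𝟙 X) = 𝟙 X
  dagger_comp {X Y Z : C} (f : X ⟶ Y) (g : Y ⟶ Z) : dagger (f ≫ g) = dagger g ≫ dagger f

/-- 1-cells between two fixed objects, with reversal of 2-cells as dagger. -/
instance {B : Type u} [Bicategory.{w, v} B] [DaggerBicategory B] (X Y : B) :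
    DaggerCategory (X ⟶ Y) where
  dagger := dag
  dagger_dagger := dag_dag
  dagger_id := dag_id
  dagger_comp := dag_comp

end Bicategories

section MonoidalCategories

open DaggerCategory MonoidalCategory

/-- A symmetric monoidal category with a dagger is a symmetric monoidal dagger category when the
dagger preserves the tensor product and the structural isomorphisms are unitary. -/
structure IsSymmetricMonoidalDagger (C : Type u) [Category.{v} C] [MonoidalCategory C]
    [SymmetricCategory C] [DaggerCategory C] : Prop where
  dagger_tensor {X X' Y Y' : C} (f : X ⟶ X') (g : Y ⟶ Y') :
    dagger (f ⊗ₘ g) = dagger f ⊗ₘ dagger g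
  dagger_associator (X Y Z : C) : dagger (α_ X Y Z).hom = (α_ X Y Z).inv
  dagger_leftUnitor (X : C) : dagger (λ_ X).hom = (λ_ X).inv
  dagger_rightUnitor (X : C) : dagger (ρ_ X).hom = (ρ_ X).inv
  dagger_braiding (X Y : C) : dagger (β_ X Y).hom = (β_ X Y).inv

/-- `X` with multiplication `m` and unit `e` is a special commutative dagger-Frobenius algebra;
its comultiplication and counit are the daggers of `m` and `e`. -/
structure IsSpecialCommDaggerFrobenius {C : Type u} [Category.{v} C] [MonoidalCategory C]
    [SymmetricCategory C] [DaggerCategory C] (X : C) (m : X ⊗ X ⟶ X) (e : 𝟙_ C ⟶ X) : Prop where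
  mul_assoc : m ▷ X ≫ m = (α_ X X X).hom ≫ X ◁ m ≫ m
  one_mul : e ▷ X ≫ m = (λ_ X).hom
  mul_one : X ◁ e ≫ m = (ρ_ X).hom
  comul_coassoc : dagger m ≫ X ◁ dagger m = dagger m ≫ dagger m ▷ X ≫ (α_ X X X).hom
  counit_comul : dagger m ≫ dagger e ▷ X = (λ_ X).inv
  comul_counit : dagger m ≫ X ◁ dagger e = (ρ_ X).inv
  frobenius_left : dagger m ▷ X ≫ (α_ X X X).hom ≫ X ◁ m = m ≫ dagger m
  frobenius_right : X ◁ dagger m ≫ (α_ X X X).inv ≫ m ▷ X = m ≫ dagger m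
  mul_comm : (β_ X X).hom ≫ m = m
  special : dagger m ≫ m = 𝟙 X

end MonoidalCategories

end SymBicat

/-! A scalar `S` can be placed on either factor of `I ⊠ I`: `lNat` carries `𝟙 I ⊠₁ S` through `l I`
to `S`, and `slide` does the same for `S ⊠₁ 𝟙 I`. As `l I` is an equivalence, a 2-cell between
scalars is determined by its whiskering with `l I`. Two such 2-cells are therefore equal as soon as
both are induced, through the same squares, by one 2-cell of `B × B`; the relation `Corresponds`
records this. By construction the crossing of `S` and `T` corresponds to the interchange `(𝟙, S) ≫
(T, 𝟙) ≅ (T, 𝟙) ≫ (𝟙, S)`, which consists of unitors alone (`corresponds_scalarBraiding`).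
Naturality and the hexagons thus become identities between unitors in `B × B`.

Symmetry compares the two placements. Exchanging the factors turns the interchange for `S, T` into
the inverse of the interchange for `T, S`, so it is enough that the braiding at `(I, I)` turns the
placement on one factor into the placement on the other. This is the Joyal–Street argument that
braiding with the unit followed by one unitor is the other unitor, carried out on naturality squares
up to invertible modification (`bNat_lNat_equiv_rNat`); the syllepsis gives the opposite direction.
The modifications found for `S` and for `T` may have different underlying 2-cells, but both must be
taken equal. Endomorphisms of `𝟙 I` are central, by the braiding already obtained, so any invertible
2-cell will do (`IsModification.replace`).

Compatibility with the dagger holds because the crossing is composed of unitary 2-cells. The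
Frobenius algebra is the usual one on the composite of two adjoint 1-cells: associativity and the
Frobenius laws are interchange, the unit laws are zigzag identities, and the comonoid is the dagger
of the monoid. -/

namespace SymBicat

/-! ### Pasting and cancelling squares up to modification -/

section SquareCalculus

open Bicategory
open scoped Pseudofunctor.StrongTrans

variable {B : Type u} [Bicategory.{w, v} B]

namespace IsModification

variable {X X' X'' Y Y' Y'' : B} {f : X ⟶ Y} {g : X' ⟶ Y'} {h : X'' ⟶ Y''}

theorem symm {p p' : X ⟶ X'} {q q' : Y ⟶ Y'} {s : Sq f p q g} {t : Sq f p' q' g}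
    {Γ : p ≅ p'} {Γ' : q ≅ q'} (H : IsModification s t Γ Γ') :
    IsModification t s Γ.symm Γ'.symm := by
  unfold IsModification at H ⊢
  have H' := congrArg (fun x => f ◁ Γ'.inv ≫ x ≫ Γ.inv ▷ g) H
  simpa using H'.symm

theorem trans {p p' p'' : X ⟶ X'} {q q' q'' : Y ⟶ Y'} {s : Sq f p q g} {t : Sq f p' q' g}
    {r : Sq f p'' q'' g} {Γ : p ≅ p'} {Γ' : q ≅ q'} {Λ : p' ≅ p''} {Λ' : q' ≅ q''}
    (H : IsModification s t Γ Γ') (K : IsModification t r Λ Λ') :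
    IsModification s r (Γ ≪≫ Λ) (Γ' ≪≫ Λ') := by
  unfold IsModification at H K ⊢
  simp [K, reassoc_of% H]

theorem vcomp_right {p p' : X ⟶ X'} {q q' : Y ⟶ Y'} {s : Sq f p q g} {t : Sq f p' q' g}
    {Γ : p ≅ p'} {Γ' : q ≅ q'} (H : IsModification s t Γ Γ') {p₁ : X' ⟶ X''} {q₁ : Y' ⟶ Y''}
    (r : Sq g p₁ q₁ h) : IsModification (s ⊚ r) (t ⊚ r) (Γ ▷ᵢ p₁) (Γ' ▷ᵢ q₁) := by
  unfold IsModification at H ⊢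
  have H' := congrArg (fun x => x ▷ q₁) H
  simp only [comp_whiskerRight] at H'
  have e : f ◁ Γ'.hom ▷ q₁ ≫ (α_ f q' q₁).inv = (α_ f q q₁).inv ≫ (f ◁ Γ'.hom) ▷ q₁ := by simp
  simp [Sq.vcomp, -whisker_assoc]
  rw [reassoc_of% e, reassoc_of% H', associator_naturality_left_assoc, ← whisker_exchange_assoc]
  simp

theorem vcomp_left {p₁ : X' ⟶ X''} {q₁ : Y' ⟶ Y''} {p₁' : X' ⟶ X''} {q₁' : Y' ⟶ Y''}
    {s : Sq g p₁ q₁ h} {t : Sq g p₁' q₁' h} {Γ : p₁ ≅ p₁'} {Γ' : q₁ ≅ q₁'}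
    (H : IsModification s t Γ Γ') {p : X ⟶ X'} {q : Y ⟶ Y'} (r : Sq f p q g) :
    IsModification (r ⊚ s) (r ⊚ t) (p ◁ᵢ Γ) (q ◁ᵢ Γ') := by
  unfold IsModification at H ⊢
  have H' := congrArg (fun x => p ◁ x) H
  simp only [Bicategory.whiskerLeft_comp] at H'
  simp [Sq.vcomp]
  rw [← reassoc_of% H', associator_inv_naturality_right_assoc, whisker_exchange_assoc]
  simp

theorem vcomp_assoc {X₃ Y₃ : B} {k : X₃ ⟶ Y₃} {p : X ⟶ X'} {q : Y ⟶ Y'} {p' : X' ⟶ X''}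
    {q' : Y' ⟶ Y''} {p'' : X'' ⟶ X₃} {q'' : Y'' ⟶ Y₃} (s : Sq f p q g) (t : Sq g p' q' h)
    (r : Sq h p'' q'' k) :
    IsModification ((s ⊚ t) ⊚ r) (s ⊚ t ⊚ r) (α_ p p' p'') (α_ q q' q'') := by
  unfold IsModification
  simp [Sq.vcomp]

theorem vid_vcomp {p : X ⟶ X'} {q : Y ⟶ Y'} (s : Sq f p q g) :
    IsModification (Sq.vid f ⊚ s) s (λ_ p) (λ_ q) := by
  unfold IsModification
  simp [Sq.vcomp, Sq.vid]

end IsModification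

variable {C : Type u₁} [Bicategory.{w₁, v₁} C]

/-- The image of a square under a pseudofunctor. -/
def mapSq (F : C ⥤ᵖ B) {X X' Y Y' : C} {f : X ⟶ Y} {p : X ⟶ X'} {q : Y ⟶ Y'} {g : X' ⟶ Y'}
    (s : Sq f p q g) : Sq (F.map f) (F.map p) (F.map q) (F.map g) :=
  (F.mapComp f q).symm ≪≫ F.map₂Iso s ≪≫ F.mapComp p g

/-- Naturality of `η` at the 2-cell `s`, with its components at the composites `f ≫ q` and `p ≫ g`
expanded by the composition axiom. It lets a square slide past the naturality squares of the unitors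
and of the braiding. -/
theorem IsModification.naturality {F G : C ⥤ᵖ B} (η : F ⟶ G) {X X' Y Y' : C} {f : X ⟶ Y}
    {p : X ⟶ X'} {q : Y ⟶ Y'} {g : X' ⟶ Y'} (s : Sq f p q g) :
    IsModification (Sq.vcomp (mapSq F s) (η.naturality g)) (Sq.vcomp (η.naturality f) (mapSq G s))
      (η.naturality p) (η.naturality q) := by
  have h₁ : (F.mapComp f q).inv ▷ η.app Y' ≫ (η.naturality (f ≫ q)).hom =
      (α_ _ _ _).hom ≫ F.map f ◁ (η.naturality q).hom ≫ (α_ _ _ _).inv ≫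
        (η.naturality f).hom ▷ G.map q ≫ (α_ _ _ _).hom ≫ η.app X ◁ (G.mapComp f q).inv := by
    rw [← cancel_epi ((F.mapComp f q).hom ▷ η.app Y'),
      ← cancel_mono (η.app X ◁ (G.mapComp f q).hom)]
    simp
  have h₂ : (F.mapComp p g).hom ▷ η.app Y' ≫ (α_ _ _ _).hom ≫ F.map p ◁ (η.naturality g).hom ≫
      (α_ _ _ _).inv ≫ (η.naturality p).hom ▷ G.map g =
      (η.naturality (p ≫ g)).hom ≫ η.app X ◁ (G.mapComp p g).hom ≫ (α_ _ _ _).inv := by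
    simp
  unfold IsModification
  simp only [Sq.vcomp, mapSq, Iso.trans_hom, Iso.symm_hom, whiskerRightIso_hom,
    whiskerLeftIso_hom, PrelaxFunctor.map₂Iso_hom, comp_whiskerRight, Category.assoc,
    Bicategory.whiskerLeft_comp]
  rw [h₂, η.naturality_naturality_assoc, reassoc_of% h₁]
  simp

/-- Two squares with the same horizontal sides, in each of which the vertical sides agree, are
equivalent when some invertible 2-cell between the vertical sides is a modification. -/
def SqEquiv {X Y : B} {f : X ⟶ X} {g : Y ⟶ Y} {p q : X ⟶ Y} (s : Sq f p p g) (t : Sq f q q g) :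
    Prop :=
  ∃ Γ : p ≅ q, IsModification s t Γ Γ

infix:50 " ≃ₛ " => SqEquiv

namespace SqEquiv

variable {X Y Z W : B} {f : X ⟶ X} {g : Y ⟶ Y} {h : Z ⟶ Z} {k : W ⟶ W}

theorem symm {p q : X ⟶ Y} {s : Sq f p p g} {t : Sq f q q g} (H : s ≃ₛ t) : t ≃ₛ s :=
  let ⟨_, h⟩ := H; ⟨_, h.symm⟩

theorem trans {p q r : X ⟶ Y} {s : Sq f p p g} {t : Sq f q q g} {u : Sq f r r g}
    (H : s ≃ₛ t) (K : t ≃ₛ u) : s ≃ₛ u :=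
  let ⟨_, h⟩ := H; let ⟨_, k⟩ := K; ⟨_, h.trans k⟩

theorem vcomp_right {p q : X ⟶ Y} {s : Sq f p p g} {t : Sq f q q g} (H : s ≃ₛ t) {r : Y ⟶ Z}
    (u : Sq g r r h) : s ⊚ u ≃ₛ t ⊚ u :=
  let ⟨_, k⟩ := H; ⟨_, k.vcomp_right u⟩

theorem vcomp_left {p q : Y ⟶ Z} {s : Sq g p p h} {t : Sq g q q h} {r : X ⟶ Y}
    (u : Sq f r r g) (H : s ≃ₛ t) : u ⊚ s ≃ₛ u ⊚ t :=
  let ⟨_, k⟩ := H; ⟨_, k.vcomp_left u⟩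

theorem vcomp_assoc {p : X ⟶ Y} {q : Y ⟶ Z} {r : Z ⟶ W} (s : Sq f p p g) (t : Sq g q q h)
    (u : Sq h r r k) : (s ⊚ t) ⊚ u ≃ₛ s ⊚ t ⊚ u :=
  ⟨_, IsModification.vcomp_assoc s t u⟩

theorem vid_vcomp {p : X ⟶ Y} (s : Sq f p p g) : Sq.vid f ⊚ s ≃ₛ s :=
  ⟨_, IsModification.vid_vcomp s⟩

theorem naturality {F G : C ⥤ᵖ B} (η : F ⟶ G) {X X' : C} {f : X ⟶ X} {p : X ⟶ X'} {g : X' ⟶ X'}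
    (s : Sq f p p g) :
    Sq.vcomp (mapSq F s) (η.naturality g) ≃ₛ Sq.vcomp (η.naturality f) (mapSq G s) :=
  ⟨_, IsModification.naturality η s⟩

end SqEquiv

/-- A 1-cell that is invertible up to invertible 2-cells. -/
def IsEquiv {X Y : B} (e : X ⟶ Y) : Prop :=
  ∃ e' : Y ⟶ X, Nonempty (𝟙 X ≅ e ≫ e') ∧ Nonempty (e' ≫ e ≅ 𝟙 Y)

namespace IsEquiv

variable {X Y Z : B}

theorem map (F : C ⥤ᵖ B) {X Y : C} {e : X ⟶ Y} (he : IsEquiv e) : IsEquiv (F.map e) := by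
  obtain ⟨e', ⟨η⟩, ⟨κ⟩⟩ := he
  exact ⟨F.map e', ⟨(F.mapId X).symm ≪≫ F.map₂Iso η ≪≫ F.mapComp e e'⟩,
    ⟨(F.mapComp e' e).symm ≪≫ F.map₂Iso κ ≪≫ F.mapId Y⟩⟩

/-- Conjugation by `κ` recovers `η` from `e' ◁ e ◁ η`; no triangle identity is needed. -/
theorem whiskerLeft_injective {e : X ⟶ Y} (he : IsEquiv e) {f g : Y ⟶ Z} {η θ : f ⟶ g}
    (h : e ◁ η = e ◁ θ) : η = θ := by
  obtain ⟨e', -, ⟨κ⟩⟩ := he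
  have key (η : f ⟶ g) : η = (λ_ f).inv ≫ κ.inv ▷ f ≫ (α_ e' e f).hom ≫ e' ◁ e ◁ η ≫
      (α_ e' e g).inv ≫ κ.hom ▷ g ≫ (λ_ g).hom := by
    rw [associator_inv_naturality_right_assoc, whisker_exchange_assoc]
    simp
  rw [key η, key θ, h]

theorem inverse {e : X ⟶ Y} {e' : Y ⟶ X} (η : 𝟙 X ≅ e ≫ e') (κ : e' ≫ e ≅ 𝟙 Y) : IsEquiv e' :=
  ⟨e, ⟨κ.symm⟩, ⟨η.symm⟩⟩

end IsEquiv

/-- After a further whiskering with `e'`, both sides are the conjugate by `κ` of the same 2-cell,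
and `e'` is itself an equivalence. -/
theorem whiskerLeft_cancelLeft_hom {X Y Z : B} {f g : Y ⟶ Z} {e : X ⟶ Y} {e' : Y ⟶ X}
    (η : 𝟙 X ≅ e ≫ e') (κ : e' ≫ e ≅ 𝟙 Y) (s : e ≫ f ≅ e ≫ g) :
    e ◁ (cancelLeft κ s).hom = s.hom := by
  apply (IsEquiv.inverse η κ).whiskerLeft_injective
  have : e' ◁ e ◁ (cancelLeft κ s).hom = (α_ e' e f).inv ≫ κ.hom ▷ f ≫ (λ_ f).hom ≫
      (cancelLeft κ s).hom ≫ (λ_ g).inv ≫ κ.inv ▷ g ≫ (α_ e' e g).hom := by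
    rw [leftUnitor_inv_naturality_assoc, whisker_exchange_assoc]
    simp
  rw [this]
  simp [cancelLeft]

theorem IsEquiv.whiskerLeft_surjective {X Y Z : B} {e : X ⟶ Y} (he : IsEquiv e) {f g : Y ⟶ Z}
    (s : e ≫ f ≅ e ≫ g) : ∃ t : f ≅ g, e ◁ᵢ t = s := by
  obtain ⟨e', ⟨η⟩, ⟨κ⟩⟩ := he
  exact ⟨cancelLeft κ s, Iso.ext (whiskerLeft_cancelLeft_hom η κ s)⟩

/-- The given modification has components `r ≫ p ≅ r ≫ q`; whiskering with an equivalence is full on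
isomorphisms, so it descends to `p ≅ q`, and faithful, so the modification condition descends with
it. -/
theorem SqEquiv.cancel_left {X Y Z : B} {f : X ⟶ X} {g : Y ⟶ Y} {h : Z ⟶ Z} {p q : Y ⟶ Z}
    {s : Sq g p p h} {t : Sq g q q h} {r : X ⟶ Y} (hr : IsEquiv r) (u : Sq f r r g)
    (H : u ⊚ s ≃ₛ u ⊚ t) : s ≃ₛ t := by
  obtain ⟨Γ, H⟩ := H
  obtain ⟨Γ, rfl⟩ := hr.whiskerLeft_surjective Γ
  refine ⟨Γ, hr.whiskerLeft_injective ?_⟩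
  unfold IsModification at H
  simp [Sq.vcomp] at H
  rw [associator_inv_naturality_right_assoc, whisker_exchange_assoc] at H
  simp only [comp_whiskerLeft, Category.assoc, Iso.inv_hom_id_assoc] at H
  rw [cancel_epi, cancel_epi, cancel_epi, ← Category.assoc, ← Category.assoc (r ◁ s.hom),
    cancel_mono] at H
  simpa using H

end SquareCalculus

/-! ### Braiding with the unit object -/

section UnitBraiding

open Bicategory PentagonatorData HexagonatorData SyllepticMonoidalBicategory
open scoped Pseudofunctor.StrongTrans

variable {B : Type u} [Bicategory.{w, v} B]

theorem mapSq_id {X Y X' Y' : B} {f : X ⟶ Y} {p : X ⟶ X'} {q : Y ⟶ Y'} {g : X' ⟶ Y'}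
    (s : Sq f p q g) : mapSq (Pseudofunctor.id B) s = s := by
  ext
  exact (Category.id_comp _).trans (Category.comp_id _)

theorem tMap₂_comp [TensorBicategory B] {X X' Y Y' : B} {f f' f'' : X ⟶ X'} {g g' g'' : Y ⟶ Y'}
    (η : f ⟶ f') (η' : f' ⟶ f'') (θ : g ⟶ g') (θ' : g' ⟶ g'') :
    tMap₂ (η ≫ η') (θ ≫ θ') = tMap₂ η θ ≫ tMap₂ η' θ' :=
  (TensorBicategory.tensor (B := B)).map₂_comp (a := (X, Y)) (b := (X', Y')) (f := (f, g))
    (g := (f', g')) (h := (f'', g'')) (η, θ) (η', θ')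

theorem tMap₂_comp_assoc [TensorBicategory B] {X X' Y Y' : B} {f f' f'' : X ⟶ X'}
    {g g' g'' : Y ⟶ Y'} (η : f ⟶ f') (η' : f' ⟶ f'') (θ : g ⟶ g') (θ' : g' ⟶ g'')
    {k : X ⊠ Y ⟶ X' ⊠ Y'} (ζ : f'' ⊠₁ g'' ⟶ k) :
    tMap₂ (η ≫ η') (θ ≫ θ') ≫ ζ = tMap₂ η θ ≫ tMap₂ η' θ' ≫ ζ := by
  rw [tMap₂_comp, Category.assoc]

theorem tMap₂_id [TensorBicategory B] {X X' Y Y' : B} (f : X ⟶ X') (g : Y ⟶ Y') :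
    tMap₂ (𝟙 f) (𝟙 g) = 𝟙 (f ⊠₁ g) :=
  (TensorBicategory.tensor (B := B)).map₂_id (a := (X, Y)) (b := (X', Y')) (f, g)

@[simp]
theorem tIso_hom [TensorBicategory B] {X X' Y Y' : B} {f f' : X ⟶ X'} {g g' : Y ⟶ Y'}
    (η : f ≅ f') (θ : g ≅ g') : (η ⊠ᵢ θ).hom = tMap₂ η.hom θ.hom := rfl

@[simp]
theorem tIso_inv [TensorBicategory B] {X X' Y Y' : B} {f f' : X ⟶ X'} {g g' : Y ⟶ Y'}
    (η : f ≅ f') (θ : g ≅ g') : (η ⊠ᵢ θ).inv = tMap₂ η.inv θ.inv := rfl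

theorem swapTensor_mapComp [TensorBicategory B] {X Y Z : B × B} (f : X ⟶ Y) (g : Y ⟶ Z) :
    (swapTensor B).mapComp f g = tComp f.2 g.2 f.1 g.1 := by
  ext
  exact (congrArg (· ≫ (tComp f.2 g.2 f.1 g.1).hom)
    (tMap₂_id (f.2 ≫ g.2) (f.1 ≫ g.1))).trans (Category.id_comp _)

theorem mapSq_swapTensor [TensorBicategory B] {X X' Y Y' Z Z' W W' : B}
    {f : X ⟶ Y} {p : X ⟶ X'} {q : Y ⟶ Y'} {g : X' ⟶ Y'}
    {f' : Z ⟶ W} {p' : Z ⟶ Z'} {q' : W ⟶ W'} {g' : Z' ⟶ W'}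
    (s : Sq f p q g) (t : Sq f' p' q' g') :
    mapSq (swapTensor B) (X := (X, Z)) (Y := (Y, W)) (X' := (X', Z'))
      (Y' := (Y', W')) (f := (f, f')) (p := (p, p')) (q := (q, q')) (g := (g, g'))
      (Iso.prod s t) = t ⊠ₛ s := by
  unfold mapSq
  rw [swapTensor_mapComp, swapTensor_mapComp]
  rfl

theorem Sq.tensor_vid_left_hom [TensorBicategory B] (Z : B) {X Y : B} {f : X ⟶ X} {p : X ⟶ Y}
    {g : Y ⟶ Y} (s : Sq f p p g) :
    (Sq.vid (𝟙 Z) ⊠ₛ s).hom =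
      (tComp (𝟙 Z) (𝟙 Z) f p).inv ≫ tMap₂ (𝟙 (𝟙 Z ≫ 𝟙 Z)) s.hom ≫ (tComp (𝟙 Z) (𝟙 Z) p g).hom := by
  simp [Sq.tensor, Sq.vid]

theorem Sq.tensor_vid_right_hom [TensorBicategory B] (Z : B) {X Y : B} {f : X ⟶ X} {p : X ⟶ Y}
    {g : Y ⟶ Y} (s : Sq f p p g) :
    (s ⊠ₛ Sq.vid (𝟙 Z)).hom =
      (tComp f p (𝟙 Z) (𝟙 Z)).inv ≫ tMap₂ s.hom (𝟙 (𝟙 Z ≫ 𝟙 Z)) ≫ (tComp p g (𝟙 Z) (𝟙 Z)).hom := by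
  simp [Sq.tensor, Sq.vid]

/-- The unitors of `𝟙 I` in the composition constraints of `unitTensor` cancel across `s`, and the
2-cell of `Sq.vid (𝟙 I)` is an identity because the two unitors agree at `𝟙 I`. -/
theorem mapSq_unitTensor [CoherenceData B] {X Y : B} {f : X ⟶ X} {p : X ⟶ Y} {g : Y ⟶ Y}
    (s : Sq f p p g) : mapSq (unitTensor B) s = Sq.vid (𝟙 I) ⊠ₛ s := by
  have h {Z : B} (k : X ⟶ Y) (q : Y ⟶ Z) : ((unitTensor B).mapComp k q) =
      (ρ_ (𝟙 (I : B))).symm ⊠ᵢ Iso.refl (k ≫ q) ≪≫ tComp (𝟙 I) (𝟙 I) k q := by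
    ext
    rfl
  have h' {Z : B} (k : X ⟶ X) (q : X ⟶ Z) : ((unitTensor B).mapComp k q) =
      (ρ_ (𝟙 (I : B))).symm ⊠ᵢ Iso.refl (k ≫ q) ≪≫ tComp (𝟙 I) (𝟙 I) k q := by
    ext
    rfl
  have h₂ : ((unitTensor B).map₂Iso s) = Iso.refl (𝟙 (I : B)) ⊠ᵢ s := rfl
  ext
  rw [Sq.tensor_vid_left_hom]
  unfold mapSq
  rw [h, h', h₂]
  change (((ρ_ (𝟙 (I : B))).symm ⊠ᵢ Iso.refl (f ≫ p) ≪≫ tComp (𝟙 I) (𝟙 I) f p).symm ≪≫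
    Iso.refl (𝟙 (I : B)) ⊠ᵢ s ≪≫ (ρ_ (𝟙 (I : B))).symm ⊠ᵢ Iso.refl (p ≫ g) ≪≫
    tComp (𝟙 I) (𝟙 I) p g).hom = _
  simp [← tMap₂_comp_assoc]

theorem mapSq_tensorUnit [CoherenceData B] {X Y : B} {f : X ⟶ X} {p : X ⟶ Y} {g : Y ⟶ Y}
    (s : Sq f p p g) : mapSq (tensorUnit B) s = s ⊠ₛ Sq.vid (𝟙 I) := by
  have h {Z : B} (k : X ⟶ Y) (q : Y ⟶ Z) : ((tensorUnit B).mapComp k q) =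
      Iso.refl (k ≫ q) ⊠ᵢ (λ_ (𝟙 (I : B))).symm ≪≫ tComp k q (𝟙 I) (𝟙 I) := by
    ext
    rfl
  have h' {Z : B} (k : X ⟶ X) (q : X ⟶ Z) : ((tensorUnit B).mapComp k q) =
      Iso.refl (k ≫ q) ⊠ᵢ (λ_ (𝟙 (I : B))).symm ≪≫ tComp k q (𝟙 I) (𝟙 I) := by
    ext
    rfl
  have h₂ : ((tensorUnit B).map₂Iso s) = s ⊠ᵢ Iso.refl (𝟙 (I : B)) := rfl
  ext
  rw [Sq.tensor_vid_right_hom]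
  unfold mapSq
  rw [h, h', h₂]
  change ((Iso.refl (f ≫ p) ⊠ᵢ (λ_ (𝟙 (I : B))).symm ≪≫ tComp f p (𝟙 I) (𝟙 I)).symm ≪≫
    s ⊠ᵢ Iso.refl (𝟙 (I : B)) ≪≫ Iso.refl (p ≫ g) ⊠ᵢ (λ_ (𝟙 (I : B))).symm ≪≫
    tComp p g (𝟙 I) (𝟙 I)).hom = _
  simp [← tMap₂_comp_assoc]

theorem lNat_vcomp [CoherenceData B] {X Y : B} {f : X ⟶ X} {p : X ⟶ Y} {g : Y ⟶ Y}
    (s : Sq f p p g) : (Sq.vid (𝟙 I) ⊠ₛ s) ⊚ lNat g ≃ₛ lNat f ⊚ s := by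
  have := SqEquiv.naturality (CoherenceData.leftUnitor (B := B)).hom s
  rw [mapSq_unitTensor, mapSq_id] at this
  exact this

theorem rNat_vcomp [CoherenceData B] {X Y : B} {f : X ⟶ X} {p : X ⟶ Y} {g : Y ⟶ Y}
    (s : Sq f p p g) : (s ⊠ₛ Sq.vid (𝟙 I)) ⊚ rNat g ≃ₛ rNat f ⊚ s := by
  have := SqEquiv.naturality (CoherenceData.rightUnitor (B := B)).hom s
  rw [mapSq_tensorUnit, mapSq_id] at this
  exact this

theorem bNat_vcomp [BraidingData B] {X Y Z W : B} {f : X ⟶ X} {p : X ⟶ Y} {g : Y ⟶ Y}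
    {f' : Z ⟶ Z} {p' : Z ⟶ W} {g' : W ⟶ W} (s : Sq f p p g) (t : Sq f' p' p' g') :
    (s ⊠ₛ t) ⊚ bNat g g' ≃ₛ bNat f f' ⊚ (t ⊠ₛ s) := by
  have := SqEquiv.naturality (BraidingData.braiding (B := B)).hom (X := (X, Z)) (X' := (Y, W))
    (f := (f, f')) (p := (p, p')) (g := (g, g')) (Iso.prod s t)
  rw [mapSq_swapTensor] at this
  exact this

/-- The hexagonator at `(I, I, I)`, followed by the left unitor on the last factor, shows the claim
behind `b I I ⊠₁ 𝟙 I`, the associator and a tensor factor `I`; all of these are cancelled as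
equivalences. -/
theorem bNat_lNat_equiv_rNat [HexagonatorData B] (S : Scalars B) :
    bNat S (𝟙 I) ⊚ lNat S ≃ₛ rNat S := by
  have hex : (bNat S (𝟙 I) ⊠ₛ Sq.vid (𝟙 I) ⊚ aNat (𝟙 I) S (𝟙 I) ⊚ Sq.vid (𝟙 I) ⊠ₛ bNat S (𝟙 I)) ≃ₛ
      (aNat S (𝟙 I) (𝟙 I) ⊚ bNat S (𝟙 I ⊠₁ 𝟙 I) ⊚ aNat (𝟙 I) (𝟙 I) S) :=
    ⟨_, hexR_modification S (𝟙 I) (𝟙 I)⟩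
  have mid : aNat (𝟙 I) (𝟙 I) S ⊚ Sq.vid (𝟙 I) ⊠ₛ lNat S ≃ₛ rNat (𝟙 I) ⊠ₛ Sq.vid S :=
    ⟨_, midUnit_modification (𝟙 I) S⟩
  have right (f g : Scalars B) : rNat (f ⊠₁ g) ≃ₛ aNat f g (𝟙 I) ⊚ Sq.vid f ⊠ₛ rNat g :=
    ⟨_, rightUnit_modification f g⟩
  -- On the long side of the hexagon the left unitor becomes a right unitor on the first factor by
  -- `mid`, moves past the braiding, and merges with the associator by `right`.
  have h₁ : (aNat S (𝟙 I) (𝟙 I) ⊚ bNat S (𝟙 I ⊠₁ 𝟙 I) ⊚ aNat (𝟙 I) (𝟙 I) S) ⊚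
      Sq.vid (𝟙 I) ⊠ₛ lNat S ≃ₛ rNat (S ⊠₁ 𝟙 I) ⊚ bNat S (𝟙 I) := by
    refine (SqEquiv.vcomp_assoc _ _ _).trans ?_
    refine (SqEquiv.vcomp_left _ ((SqEquiv.vcomp_assoc _ _ _).trans
      ((mid.vcomp_left _).trans (bNat_vcomp _ _).symm))).trans ?_
    exact (SqEquiv.vcomp_assoc _ _ _).symm.trans ((right S (𝟙 I)).symm.vcomp_right _)
  have h₂ : rNat (S ⊠₁ 𝟙 I) ⊚ bNat S (𝟙 I) ≃ₛ
      bNat S (𝟙 I) ⊠ₛ Sq.vid (𝟙 I) ⊚ aNat (𝟙 I) S (𝟙 I) ⊚ Sq.vid (𝟙 I) ⊠ₛ rNat S :=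
    (rNat_vcomp _).symm.trans ((right (𝟙 I) S).vcomp_left _)
  -- Pasting with `lNat S` at the bottom allows the factor `Sq.vid (𝟙 I) ⊠ₛ _` to be stripped by
  -- naturality of the left unitor.
  have h₃ : bNat S (𝟙 I) ⊠ₛ Sq.vid (𝟙 I) ⊚ aNat (𝟙 I) S (𝟙 I) ⊚ lNat (S ⊠₁ 𝟙 I) ⊚
      bNat S (𝟙 I) ⊚ lNat S ≃ₛ
      bNat S (𝟙 I) ⊠ₛ Sq.vid (𝟙 I) ⊚ aNat (𝟙 I) S (𝟙 I) ⊚ lNat (S ⊠₁ 𝟙 I) ⊚ rNat S := by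
    have h := (((hex.vcomp_right _).trans h₁).trans h₂).vcomp_right (lNat S)
    have assoc {X Y Z W : B} {f : X ⟶ X} {g : Y ⟶ Y} {h : Z ⟶ Z} {k : W ⟶ W} {p : X ⟶ Y}
        {q : Y ⟶ Z} {r : Z ⟶ W} {r' : W ⟶ I} (s : Sq f p p g) (t : Sq g q q h) (u : Sq h r r k)
        (x : Sq k r' r' S) : (s ⊚ t ⊚ u) ⊚ x ≃ₛ s ⊚ t ⊚ u ⊚ x :=
      (SqEquiv.vcomp_assoc _ _ _).trans ((SqEquiv.vcomp_assoc _ _ _).vcomp_left _)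
    refine SqEquiv.trans ?_ (h.trans ?_)
    · refine SqEquiv.symm ((SqEquiv.vcomp_assoc _ _ _).trans
        (((lNat_vcomp (lNat S)).vcomp_left _).trans ((assoc _ _ _ _).trans ?_)))
      refine SqEquiv.vcomp_left _ (SqEquiv.vcomp_left _ ?_)
      exact (SqEquiv.vcomp_assoc _ _ _).symm.trans
        (((lNat_vcomp _).vcomp_right _).trans (SqEquiv.vcomp_assoc _ _ _))
    · exact (assoc _ _ _ _).trans (((lNat_vcomp _).vcomp_left _).vcomp_left _)
  refine SqEquiv.cancel_left ?_ _ (SqEquiv.cancel_left ?_ _ (SqEquiv.cancel_left ?_ _ h₃))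
  · exact ⟨_, ⟨lUnit _⟩, ⟨lCounit _⟩⟩
  · exact ⟨_, ⟨aUnit _ _ _⟩, ⟨aCounit _ _ _⟩⟩
  · exact IsEquiv.map (tensorUnit B) (e := b I I) ⟨_, ⟨bUnit _ _⟩, ⟨bCounit _ _⟩⟩

theorem bNat_rNat_equiv_lNat [SyllepticMonoidalBicategory B] (S : Scalars B) :
    bNat (𝟙 I) S ⊚ rNat S ≃ₛ lNat S := by
  have syl : Sq.vid (𝟙 I ⊠₁ S) ≃ₛ bNat (𝟙 I) S ⊚ bNat S (𝟙 I) := ⟨_, syl_modification (𝟙 I) S⟩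
  exact ((bNat_lNat_equiv_rNat S).symm.vcomp_left _).trans
    ((SqEquiv.vcomp_assoc _ _ _).symm.trans
      ((syl.symm.vcomp_right _).trans (SqEquiv.vid_vcomp _)))

end UnitBraiding

/-! ### Transport of 2-cells along an equivalence -/

section Transport

open Bicategory
open scoped Pseudofunctor.StrongTrans

variable {B : Type u} [Bicategory.{w, v} B] {C : Type u₁} [Bicategory.{w₁, v₁} C]
  {Φ Ψ : C ⥤ᵖ B} {X : C} {Y : B}

/-- Horizontal pasting of squares over a pseudofunctor. -/
def Sq.hcomp {e : Φ.obj X ⟶ Y} {F G : X ⟶ X} {S T : Y ⟶ Y} (s : Sq (Φ.map F) e e S)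
    (t : Sq (Φ.map G) e e T) : Sq (Φ.map (F ≫ G)) e e (S ≫ T) :=
  Φ.mapComp F G ▷ᵢ e ≪≫ α_ _ _ _ ≪≫ Φ.map F ◁ᵢ t ≪≫ (α_ _ _ _).symm ≪≫ s ▷ᵢ T ≪≫ α_ _ _ _

/-- The 2-cell `α`, mapped by a pseudofunctor, corresponds to the 2-cell `β` under the squares
`s` and `t`. -/
def Corresponds {e : Φ.obj X ⟶ Y} {F G : X ⟶ X} {S T : Y ⟶ Y} (s : Sq (Φ.map F) e e S)
    (t : Sq (Φ.map G) e e T) (α : F ⟶ G) (β : S ⟶ T) : Prop :=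
  Φ.map₂ α ▷ e ≫ t.hom = s.hom ≫ e ◁ β

namespace Corresponds

variable {e : Φ.obj X ⟶ Y} {F G H : X ⟶ X} {S T U : Y ⟶ Y} {s : Sq (Φ.map F) e e S}
  {t : Sq (Φ.map G) e e T} {u : Sq (Φ.map H) e e U} {α : F ⟶ G} {β : S ⟶ T}

theorem comp {α' : G ⟶ H} {β' : T ⟶ U} (h : Corresponds s t α β) (h' : Corresponds t u α' β') :
    Corresponds s u (α ≫ α') (β ≫ β') := by
  unfold Corresponds at *
  simp [h', reassoc_of% h]

theorem inv {α : F ≅ G} {β : S ≅ T} (h : Corresponds s t α.hom β.hom) :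
    Corresponds t s α.inv β.inv := by
  unfold Corresponds at *
  have h' : Φ.map₂ α.inv ▷ e ≫ Φ.map₂ α.hom ▷ e = 𝟙 _ := by
    rw [← comp_whiskerRight, ← Φ.map₂_comp]
    simp
  rw [← cancel_mono (e ◁ β.hom), Category.assoc, Category.assoc, ← h, reassoc_of% h']
  simp

theorem unique (he : IsEquiv e) {β' : S ⟶ T} (h : Corresponds s t α β)
    (h' : Corresponds s t α β') : β = β' := by
  apply he.whiskerLeft_injective
  rw [← cancel_epi s.hom]
  exact h.symm.trans h'

theorem whiskerRight (h : Corresponds s t α β) (u : Sq (Φ.map H) e e U) :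
    Corresponds (s.hcomp u) (t.hcomp u) (α ▷ H) (β ▷ U) := by
  unfold Corresponds at *
  have h' := congrArg (fun x => x ▷ U) h
  simp only [comp_whiskerRight] at h'
  simp only [Sq.hcomp, Iso.trans_hom, whiskerRightIso_hom, whiskerLeftIso_hom, Iso.symm_hom,
    Φ.map₂_whisker_right, comp_whiskerRight, Category.assoc, inv_hom_whiskerRight_assoc]
  rw [associator_naturality_left_assoc, ← whisker_exchange_assoc,
    associator_inv_naturality_left_assoc, reassoc_of% h']
  simp

theorem whiskerLeft (h : Corresponds s t α β) (u : Sq (Φ.map H) e e U) :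
    Corresponds (u.hcomp s) (u.hcomp t) (H ◁ α) (U ◁ β) := by
  unfold Corresponds at *
  have h' := congrArg (fun x => Φ.map H ◁ x) h
  simp only [Bicategory.whiskerLeft_comp] at h'
  simp only [Sq.hcomp, Iso.trans_hom, whiskerRightIso_hom, whiskerLeftIso_hom, Iso.symm_hom,
    Φ.map₂_whisker_left, comp_whiskerRight, Category.assoc, inv_hom_whiskerRight_assoc]
  rw [associator_naturality_middle_assoc, reassoc_of% h', associator_inv_naturality_right_assoc,
    whisker_exchange_assoc]
  simp

theorem assoc (s : Sq (Φ.map F) e e S) (t : Sq (Φ.map G) e e T) (u : Sq (Φ.map H) e e U) :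
    Corresponds ((s.hcomp t).hcomp u) (s.hcomp (t.hcomp u)) (α_ F G H).hom (α_ S T U).hom := by
  unfold Corresponds
  simp [Sq.hcomp, Φ.map₂_associator]
  rw [← associator_inv_naturality_left_assoc, whisker_exchange_assoc,
    ← associator_naturality_left_assoc]
  simp

/-- Allows the comparison 1-cell `e` to be exchanged for an isomorphic one: between `r I` and `l I`,
and between `b I I ≫ l I` and `l I`. -/
theorem of_isModification {e' : Φ.obj X ⟶ Y} {s' : Sq (Φ.map F) e' e' S}
    {t' : Sq (Φ.map G) e' e' T} {Γ : e ≅ e'} (hs : IsModification s s' Γ Γ)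
    (ht : IsModification t t' Γ Γ) (h : Corresponds s t α β) : Corresponds s' t' α β := by
  unfold Corresponds IsModification at *
  rw [← cancel_epi (Φ.map F ◁ Γ.hom), whisker_exchange_assoc, ht, reassoc_of% hs, reassoc_of% h,
    whisker_exchange]

/-- Changes the pseudofunctor along `η`; with `η` the braiding this passes from the swapped tensor
product to the tensor product. -/
theorem naturality_vcomp (η : Φ ⟶ Ψ) {e : Ψ.obj X ⟶ Y} {s : Sq (Ψ.map F) e e S}
    {t : Sq (Ψ.map G) e e T} (h : Corresponds s t α β) :
    Corresponds (Sq.vcomp (η.naturality F) s) (Sq.vcomp (η.naturality G) t) α β := by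
  unfold Corresponds at *
  have h₁ := congrArg (fun x => x ▷ e) (η.naturality_naturality α)
  have h₂ := congrArg (fun x => η.app X ◁ x) h
  simp only [comp_whiskerRight, Bicategory.whiskerLeft_comp] at h₁ h₂
  simp only [Sq.vcomp, Iso.trans_hom, whiskerRightIso_hom, whiskerLeftIso_hom, Iso.symm_hom,
    Category.assoc]
  rw [associator_inv_naturality_left_assoc, reassoc_of% h₁, associator_naturality_middle_assoc,
    reassoc_of% h₂]
  simp

end Corresponds

theorem IsModification.hcomp {e e' : Φ.obj X ⟶ Y} {F G : X ⟶ X} {S T : Y ⟶ Y}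
    {s : Sq (Φ.map F) e e S} {s' : Sq (Φ.map F) e' e' S} {t : Sq (Φ.map G) e e T}
    {t' : Sq (Φ.map G) e' e' T} {Γ : e ≅ e'} (hs : IsModification s s' Γ Γ)
    (ht : IsModification t t' Γ Γ) : IsModification (s.hcomp t) (s'.hcomp t') Γ Γ := by
  unfold IsModification at *
  have h₁ := congrArg (fun x => x ▷ T) hs
  have h₂ := congrArg (fun x => Φ.map F ◁ x) ht
  simp only [comp_whiskerRight, Bicategory.whiskerLeft_comp] at h₁ h₂
  simp only [Sq.hcomp, Iso.trans_hom, whiskerRightIso_hom, whiskerLeftIso_hom, Iso.symm_hom,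
    Category.assoc]
  rw [whisker_exchange_assoc, associator_naturality_right_assoc, reassoc_of% h₂]
  have h₃ : Φ.map F ◁ Γ.hom ▷ T ≫ (α_ (Φ.map F) e' T).inv =
    (α_ (Φ.map F) e T).inv ≫ (Φ.map F ◁ Γ.hom) ▷ T := by simp
  rw [reassoc_of% h₃, reassoc_of% h₁]
  simp

theorem Sq.naturality_vcomp_hcomp (η : Φ ⟶ Ψ) {e : Ψ.obj X ⟶ Y} {F G : X ⟶ X} {S T : Y ⟶ Y}
    (s : Sq (Ψ.map F) e e S) (t : Sq (Ψ.map G) e e T) :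
    Sq.vcomp (η.naturality (F ≫ G)) (s.hcomp t) =
      Sq.hcomp (Sq.vcomp (η.naturality F) s) (Sq.vcomp (η.naturality G) t) := by
  have h := congrArg (fun x => x ▷ e) (η.naturality_comp F G)
  simp only [comp_whiskerRight] at h
  have h₃ : (η.app X ◁ (Ψ.mapComp F G).hom) ▷ e ≫ (α_ _ _ e).hom =
    (α_ _ _ e).hom ≫ η.app X ◁ (Ψ.mapComp F G).hom ▷ e := by simp
  ext
  simp only [Sq.hcomp, Sq.vcomp, Iso.trans_hom, whiskerRightIso_hom, whiskerLeftIso_hom,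
    Iso.symm_hom, Category.assoc, Bicategory.whiskerLeft_comp]
  rw [← reassoc_of% h₃, reassoc_of% h]
  -- The two pastings differ only in the order of `η.naturality F` and `t`, which act on disjoint
  -- parts of the composite.
  trans 𝟙 (Φ.map (F ≫ G) ≫ η.app X ≫ e) ⊗≫ (Φ.mapComp F G).hom ▷ η.app X ▷ e ⊗≫
    Φ.map F ◁ (η.naturality G).hom ▷ e ⊗≫
    ((η.naturality F).hom ▷ (Ψ.map G ≫ e) ≫ (η.app X ≫ Ψ.map F) ◁ t.hom) ⊗≫
    η.app X ◁ s.hom ▷ T ⊗≫ 𝟙 ((η.app X ≫ e) ≫ S ≫ T)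
  · bicategory
  · rw [← whisker_exchange]
    bicategory

theorem Corresponds.naturality_vcomp_hcomp (η : Φ ⟶ Ψ) {e : Ψ.obj X ⟶ Y} {F G F' G' : X ⟶ X}
    {S T S' T' : Y ⟶ Y} {s : Sq (Ψ.map F) e e S} {t : Sq (Ψ.map G) e e T}
    {s' : Sq (Ψ.map F') e e S'} {t' : Sq (Ψ.map G') e e T'} {α : F ≫ G ⟶ F' ≫ G'}
    {β : S ≫ T ⟶ S' ≫ T'} (h : Corresponds (s.hcomp t) (s'.hcomp t') α β) :
    Corresponds (Sq.hcomp (Sq.vcomp (η.naturality F) s) (Sq.vcomp (η.naturality G) t))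
      (Sq.hcomp (Sq.vcomp (η.naturality F') s') (Sq.vcomp (η.naturality G') t')) α β := by
  rw [← Sq.naturality_vcomp_hcomp, ← Sq.naturality_vcomp_hcomp]
  exact h.naturality_vcomp η

end Transport

/-! ### The braiding of scalars -/

section ScalarBraiding

open Bicategory
open scoped Pseudofunctor.StrongTrans

section

variable {B : Type u} [Bicategory.{w, v} B] [PentagonatorData B]

variable (B) in
/-- The pair of unit objects. -/
abbrev unitPair : B × B := (I, I)

/-- A scalar on the right tensor factor. -/
abbrev onRight (S : Scalars B) : unitPair B ⟶ unitPair B := (𝟙 I, S)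

/-- A scalar on the left tensor factor. -/
abbrev onLeft (S : Scalars B) : unitPair B ⟶ unitPair B := (S, 𝟙 I)

/-- A composite of scalars on the right tensor factor. -/
def onRightComp (S T : Scalars B) : onRight (S ≫ T) ≅ onRight S ≫ onRight T :=
  Iso.prod (ρ_ (𝟙 I)).symm (Iso.refl (S ≫ T))

/-- A composite of scalars on the left tensor factor. -/
def onLeftComp (S T : Scalars B) : onLeft (S ≫ T) ≅ onLeft S ≫ onLeft T :=
  Iso.prod (Iso.refl (S ≫ T)) (λ_ (𝟙 I)).symm

/-- A scalar on the right tensor factor, moved through `l I`. -/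
def rightSq (S : Scalars B) :
    Sq (TensorBicategory.tensor.map (onRight S)) (l (I : B)) (l (I : B)) S :=
  lNat S

/-- A scalar on the left tensor factor, moved through `l I`. -/
def leftSq (S : Scalars B) :
    Sq (TensorBicategory.tensor.map (onLeft S)) (l (I : B)) (l (I : B)) S :=
  slide S

/-- Interchange of scalars on different factors, in the product bicategory. -/
def pairInterchange (S T : Scalars B) : onRight S ≫ onLeft T ≅ onLeft T ≫ onRight S :=
  Iso.prod (λ_ T ≪≫ (ρ_ T).symm) (ρ_ S ≪≫ (λ_ S).symm)

theorem isEquiv_l (X : B) : IsEquiv (l X) := ⟨_, ⟨lUnit X⟩, ⟨lCounit X⟩⟩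

theorem interchange_inv (S T : Scalars B) : (interchange T S).inv =
    (tComp (𝟙 I) T S (𝟙 I)).inv ≫ tMap₂ ((λ_ T).hom ≫ (ρ_ T).inv) ((ρ_ S).hom ≫ (λ_ S).inv) ≫
      (tComp T (𝟙 I) (𝟙 I) S).hom := by
  simp [interchange, wL, wR]

omit [PentagonatorData B] in
theorem crossing_corresponds {X Y : B} {e : X ⟶ Y} {R L P Q : X ⟶ X} {S T : Y ⟶ Y}
    (ν : R ≫ e ≅ e ≫ S) (μ : L ≫ e ≅ e ≫ T) (p : P ≅ R ≫ L) (q : Q ≅ L ≫ R) (θ : P ⟶ Q)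
    (x : L ≫ R ≅ R ≫ L) (hx : x.inv = p.inv ≫ θ ≫ q.hom) :
    θ ▷ e ≫ (q ▷ᵢ e ≪≫ α_ _ _ _ ≪≫ L ◁ᵢ ν ≪≫ (α_ _ _ _).symm ≪≫ μ ▷ᵢ S ≪≫ α_ _ _ _).hom =
      (p ▷ᵢ e ≪≫ α_ _ _ _ ≪≫ R ◁ᵢ μ ≪≫ (α_ _ _ _).symm ≪≫ ν ▷ᵢ T ≪≫ α_ _ _ _).hom ≫
        ((α_ e S T).symm ≪≫ ν.symm ▷ᵢ T ≪≫ α_ R e T ≪≫ R ◁ᵢ μ.symm ≪≫ (α_ R L e).symm ≪≫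
          x.symm ▷ᵢ e ≪≫ α_ L R e ≪≫ L ◁ᵢ ν ≪≫ (α_ L e S).symm ≪≫ μ ▷ᵢ S ≪≫ α_ e T S).hom := by
  simp [hx]

/-- Whiskering `scalarBraiding` with `l I` gives back `crossing`, whose first and last steps cancel
against the squares `rightSq` and `leftSq`. What remains is the tensor product applied to the
interchange of `B × B`. -/
theorem corresponds_scalarBraiding (S T : Scalars B) :
    Corresponds ((rightSq S).hcomp (leftSq T)) ((leftSq T).hcomp (rightSq S))
      (pairInterchange S T).hom (scalarBraiding S T).hom := by
  have h : l I ◁ (scalarBraiding S T).hom = (crossing S T).hom :=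
    whiskerLeft_cancelLeft_hom (lUnit I) _ _
  exact (crossing_corresponds (lNat S) (slide T) (tComp (𝟙 I) T S (𝟙 I)) (tComp T (𝟙 I) (𝟙 I) S)
    (tMap₂ ((λ_ T).hom ≫ (ρ_ T).inv) ((ρ_ S).hom ≫ (λ_ S).inv)) (interchange T S)
    (interchange_inv S T)).trans (congrArg (((rightSq S).hcomp (leftSq T)).hom ≫ ·) h.symm)

theorem corresponds_rightSq {S T : Scalars B} (η : S ⟶ T) :
    Corresponds (rightSq S) (rightSq T) (F := onRight S) (G := onRight T) (𝟙 (𝟙 I), η) η :=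
  (CoherenceData.leftUnitor (B := B)).hom.naturality_naturality η

/-- A scalar on the left tensor factor, moved through `r I`. -/
def leftSq' (S : Scalars B) :
    Sq (TensorBicategory.tensor.map (onLeft S)) (r (I : B)) (r (I : B)) S :=
  rNat S

theorem isModification_slide (S : Scalars B) :
    IsModification (slide S) (rNat S) unitorComparison unitorComparison := by
  simp [IsModification, slide]

theorem isModification_leftSq (S : Scalars B) :
    IsModification (leftSq S) (leftSq' S) unitorComparison unitorComparison :=
  isModification_slide S

theorem corresponds_leftSq' {S T : Scalars B} (η : S ⟶ T) :
    Corresponds (leftSq' S) (leftSq' T) (F := onLeft S) (G := onLeft T) (η, 𝟙 (𝟙 I)) η :=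
  (CoherenceData.rightUnitor (B := B)).hom.naturality_naturality η

/-- Naturality on the left factor is that of the right unitor; `unitorComparison` transfers it from
`r I` to `l I`. -/
theorem corresponds_leftSq {S T : Scalars B} (η : S ⟶ T) :
    Corresponds (leftSq S) (leftSq T) (F := onLeft S) (G := onLeft T) (η, 𝟙 (𝟙 I)) η :=
  Corresponds.of_isModification (isModification_leftSq S).symm (isModification_leftSq T).symm
    (corresponds_leftSq' η)

theorem corresponds_rightSq_comp (S T : Scalars B) :
    Corresponds (rightSq (S ≫ T)) ((rightSq S).hcomp (rightSq T))
      (onRightComp S T).hom (Iso.refl (S ≫ T)).hom := by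
  exact ((CoherenceData.leftUnitor (B := B)).hom.naturality_comp S T |>.trans
    (comp_whiskerRight_assoc (tMap₂ (ρ_ (𝟙 I)).inv (𝟙 (S ≫ T))) (tComp (𝟙 I) (𝟙 I) S T).hom
      (l I) _)).symm

theorem corresponds_leftSq_comp (S T : Scalars B) :
    Corresponds (leftSq (S ≫ T)) ((leftSq S).hcomp (leftSq T))
      (onLeftComp S T).hom (Iso.refl (S ≫ T)).hom := by
  refine Corresponds.of_isModification (isModification_leftSq (S ≫ T)).symm
    ((isModification_leftSq S).symm.hcomp (isModification_leftSq T).symm) ?_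
  exact ((CoherenceData.rightUnitor (B := B)).hom.naturality_comp S T |>.trans
    (comp_whiskerRight_assoc (tMap₂ (𝟙 (S ≫ T)) (λ_ (𝟙 I)).inv) (tComp S T (𝟙 I) (𝟙 I)).hom
      (r I) _)).symm

/-- Equality of 2-cells between composites of scalars can be tested on the corresponding 2-cells
in the product bicategory. -/
theorem eq_of_corresponds {F G : unitPair B ⟶ unitPair B} {S T : Scalars B}
    {s : Sq (TensorBicategory.tensor.map F) (l (I : B)) (l (I : B)) S}
    {t : Sq (TensorBicategory.tensor.map G) (l (I : B)) (l (I : B)) T} {α α' : F ⟶ G}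
    {β β' : S ⟶ T} (h : Corresponds s t α β) (h' : Corresponds s t α' β')
    (h₁ : α.1 = α'.1) (h₂ : α.2 = α'.2) : β = β' := by
  obtain rfl : α = α' := Prod.ext h₁ h₂
  exact h.unique (isEquiv_l I) h'

theorem scalarBraiding_naturality_right (S : Scalars B) {T T' : Scalars B} (η : T ⟶ T') :
    S ◁ η ≫ (scalarBraiding S T').hom = (scalarBraiding S T).hom ≫ η ▷ S := by
  refine eq_of_corresponds (((corresponds_leftSq η).whiskerLeft (rightSq S)).comp
    (corresponds_scalarBraiding S T')) ((corresponds_scalarBraiding S T).comp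
      ((corresponds_leftSq η).whiskerRight (rightSq S))) ?_ ?_
  · simp [pairInterchange]
  · simp [pairInterchange]

theorem scalarBraiding_naturality_left {S S' : Scalars B} (η : S ⟶ S') (T : Scalars B) :
    η ▷ T ≫ (scalarBraiding S' T).hom = (scalarBraiding S T).hom ≫ T ◁ η := by
  refine eq_of_corresponds (((corresponds_rightSq η).whiskerRight (leftSq T)).comp
    (corresponds_scalarBraiding S' T)) ((corresponds_scalarBraiding S T).comp
      ((corresponds_rightSq η).whiskerLeft (leftSq T))) ?_ ?_
  · simp [pairInterchange]
  · simp [pairInterchange]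

/-- Both sides correspond to 2-cells of `B × B` made of unitors and associators, which agree in each
component by coherence. -/
theorem scalarBraiding_hexagon_forward (S T U : Scalars B) :
    (α_ S T U).hom ≫ (scalarBraiding S (T ≫ U)).hom ≫ (α_ T U S).hom =
      (scalarBraiding S T).hom ▷ U ≫ (α_ T S U).hom ≫ T ◁ (scalarBraiding S U).hom := by
  -- `onLeft (T ≫ U)` and `onLeft T ≫ onLeft U` differ by a unitor on the idle factor, where `𝟙 I`
  -- faces `𝟙 I ≫ 𝟙 I`; on scalars this 2-cell corresponds to an identity.
  have split := (corresponds_leftSq_comp T U).inv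
  have h₁ := (Corresponds.assoc (rightSq S) (leftSq T) (leftSq U)).comp
    ((split.whiskerLeft (rightSq S)).comp ((corresponds_scalarBraiding S (T ≫ U)).comp
      (((corresponds_leftSq_comp T U).whiskerRight (rightSq S)).comp
        (Corresponds.assoc (leftSq T) (leftSq U) (rightSq S)))))
  have h₂ := ((corresponds_scalarBraiding S T).whiskerRight (leftSq U)).comp
    ((Corresponds.assoc (leftSq T) (rightSq S) (leftSq U)).comp
      ((corresponds_scalarBraiding S U).whiskerLeft (leftSq T)))
  have h := eq_of_corresponds h₁ h₂ ?_ ?_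
  · simpa using h
  · simp [pairInterchange, onLeftComp]
  · simp [pairInterchange, onLeftComp]

theorem scalarBraiding_hexagon_reverse (S T U : Scalars B) :
    (α_ S T U).inv ≫ (scalarBraiding (S ≫ T) U).hom ≫ (α_ U S T).inv =
      S ◁ (scalarBraiding T U).hom ≫ (α_ S U T).inv ≫ (scalarBraiding S U).hom ▷ T := by
  have split := (corresponds_rightSq_comp S T).inv
  have assoc (X Y Z : Scalars B) {F G H : unitPair B ⟶ unitPair B}
      (x : Sq (TensorBicategory.tensor.map F) (l (I : B)) (l (I : B)) X)
      (y : Sq (TensorBicategory.tensor.map G) (l (I : B)) (l (I : B)) Y)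
      (z : Sq (TensorBicategory.tensor.map H) (l (I : B)) (l (I : B)) Z) :=
    (Corresponds.assoc x y z).inv
  have h₁ := (assoc _ _ _ (rightSq S) (rightSq T) (leftSq U)).comp
    ((split.whiskerRight (leftSq U)).comp ((corresponds_scalarBraiding (S ≫ T) U).comp
      (((corresponds_rightSq_comp S T).whiskerLeft (leftSq U)).comp
        (assoc _ _ _ (leftSq U) (rightSq S) (rightSq T)))))
  have h₂ := ((corresponds_scalarBraiding T U).whiskerLeft (rightSq S)).comp
    ((assoc _ _ _ (rightSq S) (leftSq U) (rightSq T)).comp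
      ((corresponds_scalarBraiding S U).whiskerRight (rightSq T)))
  have h := eq_of_corresponds h₁ h₂ ?_ ?_
  · simpa using h
  · simp [pairInterchange, onRightComp]
  · simp [pairInterchange, onRightComp]

/-- The crossings of scalars form a braiding. -/
@[reducible]
def scalarsBraided : BraidedCategory (Scalars B) where
  braiding := scalarBraiding
  braiding_naturality_right S _ _ η := scalarBraiding_naturality_right S η
  braiding_naturality_left η T := scalarBraiding_naturality_left η T
  hexagon_forward := scalarBraiding_hexagon_forward
  hexagon_reverse := scalarBraiding_hexagon_reverse

/-- Naturality of the braiding in `φ`, since in any braided category the braiding with the unit is a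
composite of unitors. -/
theorem scalar_central (φ : 𝟙 (I : B) ⟶ 𝟙 I) (S : Scalars B) :
    (ρ_ S).inv ≫ S ◁ φ ≫ (ρ_ S).hom = (λ_ S).inv ≫ φ ▷ S ≫ (λ_ S).hom := by
  let _ : BraidedCategory (Scalars B) := scalarsBraided
  have h₁ : (scalarBraiding S (𝟙 I)).hom = (ρ_ S).hom ≫ (λ_ S).inv := braiding_tensorUnit_right S
  have h := scalarBraiding_naturality_right S φ
  rw [h₁] at h
  rw [Iso.inv_comp_eq, ← cancel_mono (λ_ S).inv]
  simpa using h

/-- `Γ` and `Γ'` differ by an automorphism of `q`. As `q` is an equivalence into `I`, this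
automorphism comes from one of `𝟙 I`, and centrality makes it a modification from `t` to itself. -/
theorem IsModification.replace {X : B} {F : X ⟶ X} {p q : X ⟶ I} {S : Scalars B}
    {s : Sq F p p S} {t : Sq F q q S} (hq : IsEquiv q) {Γ : p ≅ q} (h : IsModification s t Γ Γ)
    (Γ' : p ≅ q) : IsModification s t Γ' Γ' := by
  obtain ⟨φ, hφ⟩ := hq.whiskerLeft_surjective (ρ_ q ≪≫ Γ.symm ≪≫ Γ' ≪≫ (ρ_ q).symm)
  have hΛ : (Γ.symm ≪≫ Γ').hom = (ρ_ q).inv ≫ q ◁ φ.hom ≫ (ρ_ q).hom := by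
    have := congrArg Iso.hom hφ
    simp only [whiskerLeftIso_hom] at this
    simp [this]
  have ht : IsModification t t (Γ.symm ≪≫ Γ') (Γ.symm ≪≫ Γ') := by
    unfold IsModification
    have hc := congrArg (fun x => q ◁ x) (scalar_central φ.hom S)
    simp only [Bicategory.whiskerLeft_comp] at hc
    rw [hΛ]
    trans t.hom ≫ q ◁ (ρ_ S).inv ≫ q ◁ S ◁ φ.hom ≫ q ◁ (ρ_ S).hom
    · have h₁ : F ◁ ((ρ_ q).inv ≫ q ◁ φ.hom ≫ (ρ_ q).hom) =
          (ρ_ (F ≫ q)).inv ≫ (F ≫ q) ◁ φ.hom ≫ (ρ_ (F ≫ q)).hom := by simp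
      rw [h₁, Category.assoc, Category.assoc, ← rightUnitor_naturality, whisker_exchange_assoc,
        ← rightUnitor_inv_naturality_assoc]
      simp
    · rw [hc]
      simp
  simpa using h.trans ht

end

end ScalarBraiding

/-! ### Symmetry of the braiding of scalars -/

section ScalarSymmetry

open Bicategory
open scoped Pseudofunctor.StrongTrans

section

variable {B : Type u} [Bicategory.{w, v} B] [TensorBicategory B]

theorem Sq.hcomp_swapTensor {X Y : B} {e : X ⊠ X ⟶ Y} {f f' g g' : X ⟶ X}
    {S T : Y ⟶ Y} (s : Sq (f ⊠₁ f') e e S) (t : Sq (g ⊠₁ g') e e T) :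
    Sq.hcomp (Φ := swapTensor B) (X := (X, X)) (F := (f', f)) (G := (g', g)) s t =
      Sq.hcomp (Φ := TensorBicategory.tensor (B := B)) (X := (X, X)) (F := (f, f')) (G := (g, g'))
        s t := by
  unfold Sq.hcomp
  rw [swapTensor_mapComp]
  rfl

theorem Corresponds.swapTensor {X Y : B} {e : X ⊠ X ⟶ Y} {f f' g g' h h' k k' : X ⟶ X}
    {S T S' T' : Y ⟶ Y} {s : Sq (f ⊠₁ f') e e S} {t : Sq (g ⊠₁ g') e e T}
    {s' : Sq (h ⊠₁ h') e e S'} {t' : Sq (k ⊠₁ k') e e T'} {α : f ≫ g ⟶ h ≫ k}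
    {α' : f' ≫ g' ⟶ h' ≫ k'} {β : S ≫ T ⟶ S' ≫ T'}
    (H : Corresponds
      (Sq.hcomp (Φ := TensorBicategory.tensor (B := B)) (X := (X, X)) (F := (f, f'))
        (G := (g, g')) s t)
      (Sq.hcomp (Φ := TensorBicategory.tensor (B := B)) (X := (X, X)) (F := (h, h'))
        (G := (k, k')) s' t') (α, α') β) :
    Corresponds
      (Sq.hcomp (Φ := SymBicat.swapTensor B) (X := (X, X)) (F := (f', f)) (G := (g', g)) s t)
      (Sq.hcomp (Φ := SymBicat.swapTensor B) (X := (X, X)) (F := (h', h)) (G := (k', k)) s' t')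
      (α', α) β := by
  have h₁ := Sq.hcomp_swapTensor s t
  have h₂ := Sq.hcomp_swapTensor s' t'
  unfold Corresponds at H ⊢
  rw [h₁, h₂]
  exact H

end

section

variable {B : Type u} [Bicategory.{w, v} B] [SyllepticMonoidalBicategory B]

theorem exists_isModification_leftSq (S : Scalars B) :
    ∃ Γ, IsModification (Sq.vcomp (bNat S (𝟙 I)) (rightSq S)) (leftSq S) Γ Γ :=
  (bNat_lNat_equiv_rNat S).trans ⟨_, (isModification_slide S).symm⟩

theorem exists_isModification_rightSq (S : Scalars B) :
    ∃ Γ, IsModification (Sq.vcomp (bNat (𝟙 I) S) (leftSq S)) (rightSq S) Γ Γ :=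
  (SqEquiv.vcomp_left _ ⟨_, isModification_slide S⟩).trans (bNat_rNat_equiv_lNat S)

/-- Transported along the braiding, the correspondence for `S, T` exhibits the crossing as induced
by the inverse interchange for `T, S`; uniqueness identifies it with the inverse of the crossing of
`T` and `S`. -/
theorem scalarBraiding_symmetric (S T : Scalars B) :
    (scalarBraiding S T).hom ≫ (scalarBraiding T S).hom = 𝟙 (S ≫ T) := by
  obtain ⟨Γ, hS⟩ := exists_isModification_leftSq S
  obtain ⟨_, hT⟩ := exists_isModification_rightSq T
  -- Horizontal pasting needs the same 2-cell `b I I ≫ l I ≅ l I` for both scalars.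
  replace hT := hT.replace (isEquiv_l I) Γ
  have h := (corresponds_scalarBraiding S T).swapTensor.naturality_vcomp_hcomp
    (BraidingData.braiding (B := B)).hom
  have h' := h.of_isModification (hS.hcomp hT) (hT.hcomp hS)
  have := h'.unique (isEquiv_l I) (corresponds_scalarBraiding T S).inv
  simp [this]

end

end ScalarSymmetry

/-! ### Unitarity of the crossing -/

section Unitary

open Bicategory DaggerBicategory

namespace IsUnitary

section

variable {B : Type u} [Bicategory.{w, v} B] [DaggerBicategory B] {X Y Z W : B}

theorem symm {f g : X ⟶ Y} {e : f ≅ g} (h : IsUnitary e) : IsUnitary e.symm := by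
  unfold IsUnitary at *
  rw [Iso.symm_hom, ← h, dag_dag, Iso.symm_inv]

theorem trans {f g h : X ⟶ Y} {e : f ≅ g} {e' : g ≅ h} (he : IsUnitary e) (he' : IsUnitary e') :
    IsUnitary (e ≪≫ e') := by
  unfold IsUnitary at *
  rw [Iso.trans_hom, dag_comp, he, he', Iso.trans_inv]

theorem whiskerLeft (f : X ⟶ Y) {g h : Y ⟶ Z} {e : g ≅ h} (he : IsUnitary e) :
    IsUnitary (f ◁ᵢ e) := by
  unfold IsUnitary at *
  rw [whiskerLeftIso_hom, dag_whiskerLeft, he, whiskerLeftIso_inv]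

theorem whiskerRight {f g : X ⟶ Y} {e : f ≅ g} (he : IsUnitary e) (h : Y ⟶ Z) :
    IsUnitary (e ▷ᵢ h) := by
  unfold IsUnitary at *
  rw [whiskerRightIso_hom, dag_whiskerRight, he, whiskerRightIso_inv]

theorem associator (f : X ⟶ Y) (g : Y ⟶ Z) (h : Z ⟶ W) : IsUnitary (α_ f g h) :=
  dag_associator f g h

theorem leftUnitor (f : X ⟶ Y) : IsUnitary (λ_ f) := dag_leftUnitor f

theorem rightUnitor (f : X ⟶ Y) : IsUnitary (ρ_ f) := dag_rightUnitor f

theorem cancelLeft {f g : Y ⟶ Z} {e : X ⟶ Y} {e' : Y ⟶ X} {κ : e' ≫ e ≅ 𝟙 Y}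
    {s : e ≫ f ≅ e ≫ g} (hκ : IsUnitary κ) (hs : IsUnitary s) :
    IsUnitary (SymBicat.cancelLeft κ s) :=
  (leftUnitor f).symm.trans ((hκ.symm.whiskerRight f).trans ((associator e' e f).trans
    ((hs.whiskerLeft e').trans ((associator e' e g).symm.trans
      ((hκ.whiskerRight g).trans (leftUnitor g))))))

theorem cancelRight {f g : X ⟶ Y} {e : Y ⟶ Z} {e' : Z ⟶ Y} {η : 𝟙 Y ≅ e ≫ e'}
    {s : f ≫ e ≅ g ≫ e} (hη : IsUnitary η) (hs : IsUnitary s) :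
    IsUnitary (SymBicat.cancelRight η s) :=
  (rightUnitor f).symm.trans ((hη.whiskerLeft f).trans ((associator f e e').symm.trans
    ((hs.whiskerRight e').trans ((associator g e e').trans
      ((hη.symm.whiskerLeft g).trans (rightUnitor g))))))

end

variable {B : Type u} [Bicategory.{w, v} B] [SymmetricMonoidalDaggerBicategory B]

open SymmetricMonoidalDaggerBicategory

theorem tensor {X X' Y Y' : B} {f f' : X ⟶ X'} {g g' : Y ⟶ Y'} {η : f ≅ f'} {θ : g ≅ g'}
    (hη : IsUnitary η) (hθ : IsUnitary θ) : IsUnitary (η ⊠ᵢ θ) := by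
  unfold IsUnitary at *
  rw [tIso_hom, dag_tensor, hη, hθ, tIso_inv]

theorem interchange {X X' Y Y' : B} (f : X ⟶ X') (g : Y ⟶ Y') :
    IsUnitary (SymBicat.interchange f g) :=
  (unitary_tComp f (𝟙 X') (𝟙 Y) g).symm.trans
    ((tensor ((rightUnitor f).trans (leftUnitor f).symm)
      ((leftUnitor g).trans (rightUnitor g).symm)).trans (unitary_tComp (𝟙 X) f g (𝟙 Y')))

theorem unitorComparison : IsUnitary (SymBicat.unitorComparison (B := B)) :=
  cancelLeft (unitary_rCounit _) ((unitary_rNat _).symm.trans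
    (whiskerRight ((unitary_leftUnit I I).trans (trans
      (whiskerLeft _ (cancelRight (unitary_lUnit I) (unitary_lNat _)).symm)
      (unitary_midUnit I I))) _ |>.trans (unitary_rNat _)))

theorem slide (T : Scalars B) : IsUnitary (SymBicat.slide T) :=
  (whiskerLeft _ unitorComparison).trans
    ((unitary_rNat T).trans (whiskerRight unitorComparison.symm T))

theorem crossing (S T : Scalars B) : IsUnitary (SymBicat.crossing S T) :=
  (associator _ S T).symm.trans <| ((unitary_lNat S).symm.whiskerRight T).trans <|
    (associator _ _ T).trans <| (whiskerLeft _ (slide T).symm).trans <|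
    (associator _ _ _).symm.trans <| ((interchange T S).symm.whiskerRight _).trans <|
    (associator _ _ _).trans <| (whiskerLeft _ (unitary_lNat S)).trans <|
    (associator _ _ S).symm.trans <| ((slide T).whiskerRight S).trans <| associator _ T S

theorem scalarBraiding (S T : Scalars B) : IsUnitary (SymBicat.scalarBraiding S T) :=
  cancelLeft (unitary_lCounit I) (crossing S T)

end IsUnitary

end Unitary

/-! ### The Frobenius algebra of a witness -/

section Frobenius

open Bicategory DaggerBicategory

section

variable {B : Type u} [Bicategory.{w, v} B] {U A : B} {into : U ⟶ A} {out : A ⟶ U}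

/-- The comultiplication induced by a copying 2-cell. -/
def comulOfCopy (copy : 𝟙 A ⟶ out ≫ into) : into ≫ out ⟶ (into ≫ out) ≫ (into ≫ out) :=
  into ◁ ((λ_ out).inv ≫ copy ▷ out ≫ (α_ out into out).hom) ≫ (α_ into out (into ≫ out)).inv

/-- The two bracketings perform two independent comparisons in opposite orders. -/
theorem mulOfCompare_assoc (compare : out ≫ into ⟶ 𝟙 A) :
    mulOfCompare compare ▷ (into ≫ out) ≫ mulOfCompare compare =
      (α_ (into ≫ out) (into ≫ out) (into ≫ out)).hom ≫
        (into ≫ out) ◁ mulOfCompare compare ≫ mulOfCompare compare := by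
  unfold mulOfCompare
  trans 𝟙 _ ⊗≫ into ◁ (compare ▷ (out ≫ into) ≫ 𝟙 A ◁ compare) ▷ out ⊗≫ 𝟙 (into ≫ out)
  · bicategory
  · rw [← whisker_exchange]
    bicategory

theorem one_mulOfCompare {create : 𝟙 U ⟶ into ≫ out} {compare : out ≫ into ⟶ 𝟙 A}
    (h : leftZigzag create compare = (λ_ into).hom ≫ (ρ_ into).inv) :
    create ▷ (into ≫ out) ≫ mulOfCompare compare = (λ_ (into ≫ out)).hom := by
  unfold mulOfCompare
  trans 𝟙 (𝟙 U ≫ into ≫ out) ⊗≫ leftZigzag create compare ▷ out ⊗≫ 𝟙 (into ≫ out)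
  · unfold leftZigzag
    bicategory
  · rw [h]
    bicategory

theorem mulOfCompare_one {create : 𝟙 U ⟶ into ≫ out} {compare : out ≫ into ⟶ 𝟙 A}
    (h : rightZigzag create compare = (ρ_ out).hom ≫ (λ_ out).inv) :
    (into ≫ out) ◁ create ≫ mulOfCompare compare = (ρ_ (into ≫ out)).hom := by
  unfold mulOfCompare
  trans 𝟙 ((into ≫ out) ≫ 𝟙 U) ⊗≫ into ◁ rightZigzag create compare ⊗≫ 𝟙 (into ≫ out)
  · unfold rightZigzag
    bicategory
  · rw [h]
    bicategory

/-- `copy` and `compare` act on disjoint parts of the composite, so their order is immaterial; no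
relation between them is used. -/
theorem mulOfCompare_frobenius_left (compare : out ≫ into ⟶ 𝟙 A) (copy : 𝟙 A ⟶ out ≫ into) :
    comulOfCopy copy ▷ (into ≫ out) ≫ (α_ _ _ _).hom ≫ (into ≫ out) ◁ mulOfCompare compare =
      mulOfCompare compare ≫ comulOfCopy copy := by
  unfold mulOfCompare comulOfCopy
  trans 𝟙 ((into ≫ out) ≫ into ≫ out) ⊗≫
    into ◁ (copy ▷ (out ≫ into) ≫ (out ≫ into) ◁ compare) ▷ out ⊗≫
    𝟙 ((into ≫ out) ≫ into ≫ out)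
  · bicategory
  · rw [← whisker_exchange]
    bicategory

theorem mulOfCompare_frobenius_right (compare : out ≫ into ⟶ 𝟙 A) (copy : 𝟙 A ⟶ out ≫ into) :
    (into ≫ out) ◁ comulOfCopy copy ≫ (α_ _ _ _).inv ≫ mulOfCompare compare ▷ (into ≫ out) =
      mulOfCompare compare ≫ comulOfCopy copy := by
  unfold mulOfCompare comulOfCopy
  trans 𝟙 ((into ≫ out) ≫ into ≫ out) ⊗≫
    into ◁ ((out ≫ into) ◁ copy ≫ compare ▷ (out ≫ into)) ▷ out ⊗≫
    𝟙 ((into ≫ out) ≫ into ≫ out)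
  · bicategory
  · rw [whisker_exchange]
    bicategory

theorem comulOfCopy_mulOfCompare {compare : out ≫ into ⟶ 𝟙 A} {copy : 𝟙 A ⟶ out ≫ into}
    (h : copy ≫ compare = 𝟙 (𝟙 A)) :
    comulOfCopy copy ≫ mulOfCompare compare = 𝟙 (into ≫ out) := by
  unfold mulOfCompare comulOfCopy
  trans 𝟙 (into ≫ out) ⊗≫ into ◁ (copy ≫ compare) ▷ out ⊗≫ 𝟙 (into ≫ out)
  · bicategory
  · rw [h]
    bicategory

theorem dag_mulOfCompare [DaggerBicategory B] (compare : out ≫ into ⟶ 𝟙 A) :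
    dag (mulOfCompare compare) = comulOfCopy (dag compare) := by
  simp [mulOfCompare, comulOfCopy, dag_comp, dag_whiskerLeft, dag_whiskerRight, dag_leftUnitor,
    ← dag_associator, dag_dag]

end

variable {B : Type u} [Bicategory.{w, v} B] [SymmetricMonoidalDaggerBicategory B]

/-- The braided category of scalars is symmetric. -/
@[reducible]
def scalarsSymmetric : SymmetricCategory (Scalars B) where
  toBraidedCategory := scalarsBraided
  symmetry := scalarBraiding_symmetric

theorem scalars_isSymmetricMonoidalDagger :
    letI := scalarsSymmetric (B := B)
    IsSymmetricMonoidalDagger (Scalars B) := by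
  let _ := scalarsSymmetric (B := B)
  exact {
    dagger_tensor := fun f g => by
      -- The dagger reverses the order of the two whiskerings that make up `f ⊗ₘ g`; interchange
      -- restores it.
      change dag (f ▷ _ ≫ _ ◁ g) = dag f ▷ _ ≫ _ ◁ dag g
      rw [dag_comp, dag_whiskerLeft, dag_whiskerRight, whisker_exchange]
    dagger_associator := dag_associator
    dagger_leftUnitor := dag_leftUnitor
    dagger_rightUnitor := dag_rightUnitor
    dagger_braiding := IsUnitary.scalarBraiding }

theorem Witness.isSpecialCommDaggerFrobenius {A : B} (W : Witness A) :
    letI := scalarsSymmetric (B := B)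
    IsSpecialCommDaggerFrobenius W.scalar W.mul W.one := by
  let _ := scalarsSymmetric (B := B)
  have hmul : dag W.mul = comulOfCopy (dag W.compare) := dag_mulOfCompare W.compare
  have assoc : W.mul ▷ W.scalar ≫ W.mul = (α_ W.scalar W.scalar W.scalar).hom ≫
    W.scalar ◁ W.mul ≫ W.mul := mulOfCompare_assoc W.compare
  have one_mul : W.one ▷ W.scalar ≫ W.mul = (λ_ W.scalar).hom := one_mulOfCompare W.yank₃
  have mul_one : W.scalar ◁ W.one ≫ W.mul = (ρ_ W.scalar).hom := mulOfCompare_one W.yank₁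
  exact {
    mul_assoc := assoc
    one_mul := one_mul
    mul_one := mul_one
    -- The comonoid laws are the daggers of the monoid laws.
    comul_coassoc := by
      have h := congrArg dag assoc
      rw [dag_comp, dag_comp, dag_comp, dag_whiskerLeft, dag_whiskerRight, dag_associator,
        Iso.eq_comp_inv, Category.assoc] at h
      exact h.symm
    counit_comul := by
      have h := congrArg dag one_mul
      rw [dag_comp, dag_whiskerRight, dag_leftUnitor] at h
      exact h
    comul_counit := by
      have h := congrArg dag mul_one
      rw [dag_comp, dag_whiskerLeft, dag_rightUnitor] at h
      exact h
    frobenius_left := by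
      change dag W.mul ▷ W.scalar ≫ (α_ W.scalar W.scalar W.scalar).hom ≫ W.scalar ◁ W.mul =
        W.mul ≫ dag W.mul
      rw [hmul]
      exact mulOfCompare_frobenius_left _ _
    frobenius_right := by
      change W.scalar ◁ dag W.mul ≫ (α_ W.scalar W.scalar W.scalar).inv ≫ W.mul ▷ W.scalar =
        W.mul ≫ dag W.mul
      rw [hmul]
      exact mulOfCompare_frobenius_right _ _
    mul_comm := W.commutes
    special := by
      change dag W.mul ≫ W.mul = 𝟙 W.scalar
      rw [hmul]
      exact comulOfCopy_mulOfCompare (by rw [← W.copy_eq, W.copy_compare]) }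

end Frobenius

end SymBicat

theorem mainTheorem5 (B : Type u) [Bicategory.{w, v} B]
    [SymBicat.SymmetricMonoidalDaggerBicategory B] :
    ∃ _ : SymmetricCategory (SymBicat.Scalars B),
      (∀ S T : SymBicat.Scalars B, BraidedCategory.braiding S T = SymBicat.scalarBraiding S T) ∧
      SymBicat.IsSymmetricMonoidalDagger (SymBicat.Scalars B) ∧
      ∀ (A : B) (W : SymBicat.Witness A),
        SymBicat.IsSpecialCommDaggerFrobenius W.scalar W.mul W.one :=
  ⟨SymBicat.scalarsSymmetric, fun _ _ => rfl, SymBicat.scalars_isSymmetricMonoidalDagger,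
    fun _ W => W.isSpecialCommDaggerFrobenius⟩
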